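/- Let $n\ge 1$ and let $H_n=\mathbb C^n\times\mathbb R$ be the Heisenberg group with the law $(x_1,z_1)(x_2,z_2)=(x_1+x_2,\,z_1+z_2+\tfrac12\operatorname{Im}(x_1\cdot x_2))$, where $x_1\cdot x_2=\sum_i\overline{x_{1,i}}\,x_{2,i}$. Let $\mathfrak h_n$ be its Lie algebra, with basis $X_1,\dots,X_n,Y_1,\dots,Y_n,Z$ given by the coordinate vectors at the identity, so that $[X_i,Y_i]=Z$ and all other brackets of basis vectors vanish; identify $\mathfrak h_n$ with $H_n$ by the exponential map. For positive integers $r_1\mid r_2\mid\cdots\mid r_n$ let $\Gamma_{\mathbf r}<H_n$ be the lattice generated by $r_1X_1,\dots,r_nX_n,Y_1,\dots,Y_n,Z$. A left-invariant sub-Riemannian metric on $\Gamma\backslash H_n$, for a lattice $\Gamma<H_n$, is given by a bracket generating subspace $\mathfrak v\subset\mathfrak h_n$ (the Riemannian case $\mathfrak v=\mathfrak h_n$ is included) and an inner product $\langle\cdot,\cdot\rangle$ on $\mathfrak v$, extended by left translation. The distance of two points is the infimum of the lengths of the absolutely continuous paths joining them that are almost everywhere tangent to the distribution. For a bracket generating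 subspace $\mathfrak w\subset\mathfrak v$, Popp's volume form $vol(\mathfrak w)$ is the left-invariant volume form (up to sign) dual to a basis of $\mathfrak h_n$ formed by a $\langle\cdot,\cdot\rangle$-orthonormal basis of $\mathfrak w$ and by vectors whose classes are an orthonormal basis of $\mathfrak h_n/\mathfrak w$ for the norm $\|\zeta\|=\min\{\|\xi\|_{HS} : \xi\in\mathfrak w\otimes\mathfrak w,\ \pi(\xi)=\zeta\}$, where $\pi(u\otimes v)=[u,v]\bmod\mathfrak w$. The minimal Popp's volume form $mvol$ is the smallest of the forms $vol(\mathfrak w)$, taken in absolute value, over all bracket generating subspaces $\mathfrak w\subset\mathfrak v$. **Proposition.** For all $n\ge 1$ and $D,V>0$ there is a constant $C=C(n,D,V)>0$ such that the following hold. 1. If $\Gamma_{\mathbf r}\backslash H_n$ carries a left-invariant sub-Riemannian metric with diameter at most $D$ and total minimal Popp's volume $\left|\int_{\Gamma_{\mathbf r}\backslash H_n}mvol\right|\ge V$, then $r_n\le C$. 2. Consider all lattices $\Gamma<H_n$ for which $\Gamma\backslash H_n$ carries a left-invariant sub-Riemannian metric with diameter at most $D$ and total minimal Popp's volume at least $V$.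 These lattices fall into at most $C$ isomorphism classes, and the manifolds $\Gamma\backslash H_n$ fall into at most $C$ diffeomorphism types. -/

import Mathlib

open MeasureTheory Set Module
open scoped Manifold ContDiff ENNReal

noncomputable section

/-- `Im (conj (x + i y) · (x' + i y')) = ∑ (xᵢ y'ᵢ - yᵢ x'ᵢ)`. -/
def sympl {n : ℕ} (x y x' y' : Fin n → ℝ) : ℝ := ∑ i, (x i * y' i - y i * x' i)

theorem sympl_add_left {n : ℕ} (x y x' y' u v : Fin n → ℝ) :
    sympl (x + x') (y + y') u v = sympl x y u v + sympl x' y' u v := by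
  simp only [sympl, Pi.add_apply, ← Finset.sum_add_distrib]
  exact Finset.sum_congr rfl fun i _ => by ring

theorem sympl_add_right {n : ℕ} (x y x' y' u v : Fin n → ℝ) :
    sympl u v (x + x') (y + y') = sympl u v x y + sympl u v x' y' := by
  simp only [sympl, Pi.add_apply, ← Finset.sum_add_distrib]
  exact Finset.sum_congr rfl fun i _ => by ring

theorem sympl_smul_right {n : ℕ} (a : ℝ) (x y u v : Fin n → ℝ) :
    sympl u v (a • x) (a • y) = a * sympl u v x y := by
  simp only [sympl, Pi.smul_apply, smul_eq_mul, Finset.mul_sum]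
  exact Finset.sum_congr rfl fun i _ => by ring

@[simp] theorem sympl_self {n : ℕ} (x y : Fin n → ℝ) : sympl x y x y = 0 := by
  simp [sympl, mul_comm]

@[simp] theorem sympl_neg_self {n : ℕ} (x y : Fin n → ℝ) : sympl (-x) (-y) x y = 0 := by
  simp [sympl, mul_comm]

@[simp] theorem sympl_zero_left {n : ℕ} (x y : Fin n → ℝ) : sympl 0 0 x y = 0 := by
  simp [sympl]

@[simp] theorem sympl_zero_right {n : ℕ} (x y : Fin n → ℝ) : sympl x y 0 0 = 0 := by
  simp [sympl]

/-- The `(2n+1)`-dimensional Heisenberg group, in the coordinates `(x, y, z)` with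
`x + i y ∈ ℂⁿ` and `z ∈ ℝ`. -/
def Heis (n : ℕ) : Type := (Fin n → ℝ) × (Fin n → ℝ) × ℝ

/-- The Lie algebra of `Heis n`, in the basis `X₁, …, Xₙ, Y₁, …, Yₙ, Z` of coordinate vectors
at the identity. -/
def HeisAlg (n : ℕ) : Type := (Fin n → ℝ) × (Fin n → ℝ) × ℝ

namespace Heis

variable {n : ℕ}

def mk (x y : Fin n → ℝ) (z : ℝ) : Heis n := (x, y, z)
def x (p : Heis n) : Fin n → ℝ := p.1
def y (p : Heis n) : Fin n → ℝ := p.2.1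
def z (p : Heis n) : ℝ := p.2.2

@[simp] theorem x_mk (a b : Fin n → ℝ) (c : ℝ) : (mk a b c).x = a := rfl
@[simp] theorem y_mk (a b : Fin n → ℝ) (c : ℝ) : (mk a b c).y = b := rfl
@[simp] theorem z_mk (a b : Fin n → ℝ) (c : ℝ) : (mk a b c).z = c := rfl

theorem ext' {p q : Heis n} (h1 : p.x = q.x) (h2 : p.y = q.y) (h3 : p.z = q.z) : p = q :=
  Prod.ext h1 (Prod.ext h2 h3)

/- The smooth structure, topology, Borel structure and Lebesgue measure of the coordinate space;
the additive structure and the norm only serve as a global chart. -/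
instance : NormedAddCommGroup (Heis n) :=
  inferInstanceAs (NormedAddCommGroup ((Fin n → ℝ) × (Fin n → ℝ) × ℝ))

instance : NormedSpace ℝ (Heis n) :=
  inferInstanceAs (NormedSpace ℝ ((Fin n → ℝ) × (Fin n → ℝ) × ℝ))

instance : LocallyCompactSpace (Heis n) :=
  inferInstanceAs (LocallyCompactSpace ((Fin n → ℝ) × (Fin n → ℝ) × ℝ))

instance : MeasureSpace (Heis n) :=
  inferInstanceAs (MeasureSpace ((Fin n → ℝ) × (Fin n → ℝ) × ℝ))

instance : BorelSpace (Heis n) :=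
  inferInstanceAs (BorelSpace ((Fin n → ℝ) × (Fin n → ℝ) × ℝ))

/-- `(x, z)(x', z') = (x + x', z + z' + ½ Im (x · x'))`. -/
instance : Mul (Heis n) :=
  ⟨fun p q => mk (p.x + q.x) (p.y + q.y) (p.z + q.z + 1 / 2 * sympl p.x p.y q.x q.y)⟩

instance : One (Heis n) := ⟨mk 0 0 0⟩

instance : Inv (Heis n) := ⟨fun p => mk (-p.x) (-p.y) (-p.z)⟩

@[simp] theorem mul_x (p q : Heis n) : (p * q).x = p.x + q.x := rfl
@[simp] theorem mul_y (p q : Heis n) : (p * q).y = p.y + q.y := rfl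
@[simp] theorem mul_z (p q : Heis n) :
    (p * q).z = p.z + q.z + 1 / 2 * sympl p.x p.y q.x q.y := rfl
@[simp] theorem one_x : (1 : Heis n).x = 0 := rfl
@[simp] theorem one_y : (1 : Heis n).y = 0 := rfl
@[simp] theorem one_z : (1 : Heis n).z = 0 := rfl
@[simp] theorem inv_x (p : Heis n) : p⁻¹.x = -p.x := rfl
@[simp] theorem inv_y (p : Heis n) : p⁻¹.y = -p.y := rfl
@[simp] theorem inv_z (p : Heis n) : p⁻¹.z = -p.z := rfl

instance : Group (Heis n) :=
  Group.ofLeftAxioms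
    (fun p q r => ext' (by simp [add_assoc]) (by simp [add_assoc])
      (by simp only [mul_x, mul_y, mul_z, sympl_add_left, sympl_add_right]; ring))
    (fun p => ext' (by simp) (by simp) (by simp))
    (fun p => ext' (by simp) (by simp) (by simp))

theorem continuous_x : Continuous (x : Heis n → Fin n → ℝ) :=
  continuous_fst (X := Fin n → ℝ) (Y := (Fin n → ℝ) × ℝ)

theorem continuous_y : Continuous (y : Heis n → Fin n → ℝ) :=
  continuous_fst.comp (continuous_snd (X := Fin n → ℝ) (Y := (Fin n → ℝ) × ℝ))

theorem continuous_z : Continuous (z : Heis n → ℝ) :=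
  continuous_snd.comp (continuous_snd (X := Fin n → ℝ) (Y := (Fin n → ℝ) × ℝ))

theorem continuous_mk {α : Type*} [TopologicalSpace α] {f g : α → Fin n → ℝ} {h : α → ℝ}
    (hf : Continuous f) (hg : Continuous g) (hh : Continuous h) :
    Continuous (fun a => mk (f a) (g a) (h a)) :=
  Continuous.prodMk (X := Fin n → ℝ) (Y := (Fin n → ℝ) × ℝ) hf (hg.prodMk hh)

instance : IsTopologicalGroup (Heis n) where
  continuous_mul := by
    have a1 := (continuous_x (n := n)).comp (continuous_fst (X := Heis n) (Y := Heis n))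
    have a2 := (continuous_y (n := n)).comp (continuous_fst (X := Heis n) (Y := Heis n))
    have a3 := (continuous_z (n := n)).comp (continuous_fst (X := Heis n) (Y := Heis n))
    have b1 := (continuous_x (n := n)).comp (continuous_snd (X := Heis n) (Y := Heis n))
    have b2 := (continuous_y (n := n)).comp (continuous_snd (X := Heis n) (Y := Heis n))
    have b3 := (continuous_z (n := n)).comp (continuous_snd (X := Heis n) (Y := Heis n))
    refine continuous_mk (a1.add b1) (a2.add b2) ((a3.add b3).add (continuous_const.mul ?_))
    refine continuous_finsetSum _ fun i _ => ?_
    exact (((continuous_apply i).comp a1).mul ((continuous_apply i).comp b2)).sub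
      (((continuous_apply i).comp a2).mul ((continuous_apply i).comp b1))
  continuous_inv := continuous_mk continuous_x.neg continuous_y.neg continuous_z.neg

/-- A discrete subgroup acts properly discontinuously by left translations, so that
`Γ \ Heis n` is a manifold whose charts are local inverses of the projection. -/
instance (Γ : Subgroup (Heis n)) [DiscreteTopology Γ] :
    ProperlyDiscontinuousSMul Γ (Heis n) :=
  Subgroup.properlyDiscontinuousSMul_of_tendsto_cofinite Γ
    (Subgroup.tendsto_coe_cofinite_of_discrete Γ
      (isDiscrete_iff_discreteTopology.mpr inferInstance))

end Heis

namespace HeisAlg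

variable {n : ℕ}

def mk (x y : Fin n → ℝ) (z : ℝ) : HeisAlg n := (x, y, z)
def x (u : HeisAlg n) : Fin n → ℝ := u.1
def y (u : HeisAlg n) : Fin n → ℝ := u.2.1
def z (u : HeisAlg n) : ℝ := u.2.2

@[simp] theorem x_mk (a b : Fin n → ℝ) (c : ℝ) : (mk a b c).x = a := rfl
@[simp] theorem y_mk (a b : Fin n → ℝ) (c : ℝ) : (mk a b c).y = b := rfl
@[simp] theorem z_mk (a b : Fin n → ℝ) (c : ℝ) : (mk a b c).z = c := rfl

theorem ext' {u v : HeisAlg n} (h1 : u.x = v.x) (h2 : u.y = v.y) (h3 : u.z = v.z) : u = v :=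
  Prod.ext h1 (Prod.ext h2 h3)

instance : AddCommGroup (HeisAlg n) :=
  inferInstanceAs (AddCommGroup ((Fin n → ℝ) × (Fin n → ℝ) × ℝ))

instance : Module ℝ (HeisAlg n) :=
  inferInstanceAs (Module ℝ ((Fin n → ℝ) × (Fin n → ℝ) × ℝ))

/-- `[Xᵢ, Yᵢ] = Z`, all other brackets of basis vectors being zero. -/
instance : Bracket (HeisAlg n) (HeisAlg n) :=
  ⟨fun u v => mk 0 0 (sympl u.x u.y v.x v.y)⟩

@[simp] theorem bracket_x (u v : HeisAlg n) : ⁅u, v⁆.x = 0 := rfl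
@[simp] theorem bracket_y (u v : HeisAlg n) : ⁅u, v⁆.y = 0 := rfl
@[simp] theorem bracket_z (u v : HeisAlg n) : ⁅u, v⁆.z = sympl u.x u.y v.x v.y := rfl
@[simp] theorem add_x (u v : HeisAlg n) : (u + v).x = u.x + v.x := rfl
@[simp] theorem add_y (u v : HeisAlg n) : (u + v).y = u.y + v.y := rfl
@[simp] theorem add_z (u v : HeisAlg n) : (u + v).z = u.z + v.z := rfl
@[simp] theorem zero_x : (0 : HeisAlg n).x = 0 := rfl
@[simp] theorem zero_y : (0 : HeisAlg n).y = 0 := rfl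
@[simp] theorem zero_z : (0 : HeisAlg n).z = 0 := rfl
@[simp] theorem smul_x (a : ℝ) (u : HeisAlg n) : (a • u).x = a • u.x := rfl
@[simp] theorem smul_y (a : ℝ) (u : HeisAlg n) : (a • u).y = a • u.y := rfl
@[simp] theorem smul_z (a : ℝ) (u : HeisAlg n) : (a • u).z = a * u.z := rfl

instance : LieRing (HeisAlg n) where
  add_lie u v w := ext' (by simp) (by simp) (by simp [sympl_add_left])
  lie_add u v w := ext' (by simp) (by simp) (by simp [sympl_add_right])
  lie_self u := ext' (by simp) (by simp) (by simp)
  leibniz_lie u v w := ext' (by simp) (by simp) (by simp)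

instance : LieAlgebra ℝ (HeisAlg n) where
  lie_smul a u v := ext' (by simp) (by simp) (by simp [sympl_smul_right])

/-- Index set of the basis `X₁, …, Xₙ, Y₁, …, Yₙ, Z`. -/
abbrev Idx (n : ℕ) : Type := Fin n ⊕ Fin n ⊕ Unit

/-- The coordinates of a vector. -/
def coordEquiv (n : ℕ) : ((Fin n → ℝ) × (Fin n → ℝ) × ℝ) ≃ₗ[ℝ] HeisAlg n where
  toFun p := mk p.1 p.2.1 p.2.2
  invFun u := (u.x, u.y, u.z)
  map_add' _ _ := rfl
  map_smul' _ _ := rfl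
  left_inv _ := rfl
  right_inv _ := rfl

@[simp] theorem coordEquiv_apply (p : (Fin n → ℝ) × (Fin n → ℝ) × ℝ) :
    coordEquiv n p = mk p.1 p.2.1 p.2.2 := rfl

/-- The basis `X₁, …, Xₙ, Y₁, …, Yₙ, Z`. -/
def stdBasis (n : ℕ) : Basis (Idx n) ℝ (HeisAlg n) :=
  ((Pi.basisFun ℝ (Fin n)).prod
    ((Pi.basisFun ℝ (Fin n)).prod (Basis.singleton Unit ℝ))).map (coordEquiv n)

theorem stdBasis_X (i : Fin n) : stdBasis n (Sum.inl i) = mk (Pi.single i 1) 0 0 := by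
  simp [stdBasis]

theorem stdBasis_Y (i : Fin n) : stdBasis n (Sum.inr (Sum.inl i)) = mk 0 (Pi.single i 1) 0 := by
  simp [stdBasis]

theorem stdBasis_Z : stdBasis n (Sum.inr (Sum.inr ())) = mk 0 0 1 := by
  simp [stdBasis]

/-- The exponential map, which is the identity in these coordinates. -/
def exp (u : HeisAlg n) : Heis n := Heis.mk u.x u.y u.z

end HeisAlg

/-- The left-trivialized velocity `(L_{c(t)})_*⁻¹ ċ(t)` of a path `c` in `Heis n`. -/
def leftVelocity {n : ℕ} (c : ℝ → Heis n) (t : ℝ) : HeisAlg n :=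
  HeisAlg.mk (deriv c t).x (deriv c t).y
    ((deriv c t).z - 1 / 2 * sympl (c t).x (c t).y (deriv c t).x (deriv c t).y)

/-- A left-invariant sub-Riemannian structure on `Heis n` (equivalently on `Γ \ Heis n`):
a bracket generating subspace of the Lie algebra with an inner product on it.
The Riemannian case `horizontal = ⊤` is included. -/
structure SubRiem (n : ℕ) where
  horizontal : Submodule ℝ (HeisAlg n)
  inner : LinearMap.BilinForm ℝ horizontal
  symm : ∀ u v, inner u v = inner v u
  pos : ∀ u, u ≠ 0 → 0 < inner u u
  generating : LieSubalgebra.lieSpan ℝ (HeisAlg n) (horizontal : Set (HeisAlg n)) = ⊤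

namespace SubRiem

variable {n : ℕ}

open Classical in
/-- The length of a left-trivialized tangent vector (`∞` if it is not horizontal). -/
def speed (S : SubRiem n) (u : HeisAlg n) : ℝ≥0∞ :=
  if h : u ∈ S.horizontal then ENNReal.ofReal √(S.inner ⟨u, h⟩ ⟨u, h⟩) else ⊤

/-- Admissible paths `[0,1] → Heis n`: absolutely continuous and almost everywhere tangent to
the left-invariant distribution. -/
def IsAdmissible (S : SubRiem n) (c : ℝ → Heis n) : Prop :=
  AbsolutelyContinuousOnInterval c 0 1 ∧
    ∀ᵐ t ∂(volume.restrict (Icc (0 : ℝ) 1)), leftVelocity c t ∈ S.horizontal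

/-- The length of a path. -/
def length (S : SubRiem n) (c : ℝ → Heis n) : ℝ≥0∞ :=
  ∫⁻ t in Icc (0 : ℝ) 1, S.speed (leftVelocity c t)

/-- The sub-Riemannian distance on `Γ \ Heis n`: the infimum of the lengths of the admissible
paths from `p` to `q`. The admissible paths in the quotient are the projections of the
admissible paths in `Heis n`, with the same length. -/
def quotDist (S : SubRiem n) (Γ : Subgroup (Heis n))
    (p q : MulAction.orbitRel.Quotient Γ (Heis n)) : ℝ≥0∞ :=
  ⨅ (c : ℝ → Heis n) (_ : S.IsAdmissible c)
    (_ : (Quotient.mk (MulAction.orbitRel Γ (Heis n)) (c 0)) = p)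
    (_ : (Quotient.mk (MulAction.orbitRel Γ (Heis n)) (c 1)) = q), S.length c

/-- The diameter of `Γ \ Heis n`. -/
def diam (S : SubRiem n) (Γ : Subgroup (Heis n)) : ℝ≥0∞ :=
  ⨆ (p : MulAction.orbitRel.Quotient Γ (Heis n)) (q : MulAction.orbitRel.Quotient Γ (Heis n)),
    S.quotDist Γ p q

/-- The structure induced on a smaller bracket generating subspace. -/
def restrict (S : SubRiem n) (W : Submodule ℝ (HeisAlg n)) (hW : W ≤ S.horizontal)
    (hgen : LieSubalgebra.lieSpan ℝ (HeisAlg n) (W : Set (HeisAlg n)) = ⊤) : SubRiem n where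
  horizontal := W
  inner := S.inner.compl₁₂ (Submodule.inclusion hW) (Submodule.inclusion hW)
  symm u v := S.symm _ _
  pos u hu := S.pos _ fun h => hu (Submodule.inclusion_injective hW (by rw [h, map_zero]))
  generating := hgen

/-- The norm on `(𝔳 + [𝔳, 𝔳]) / 𝔳` of the class of `z`: the minimum of the Hilbert–Schmidt norms
of the tensors `∑ aᵢⱼ eᵢ ⊗ eⱼ ∈ 𝔳 ⊗ 𝔳` (`e` an orthonormal basis of the horizontal space `𝔳`)
that the bracket sends to the class of `z`. -/
def poppNorm (S : SubRiem n) (z : HeisAlg n) : ℝ :=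
  sInf {s : ℝ | ∃ e : Basis (Fin (finrank ℝ S.horizontal)) ℝ S.horizontal,
    (∀ i j, S.inner (e i) (e j) = if i = j then 1 else 0) ∧
    ∃ a : Matrix (Fin (finrank ℝ S.horizontal)) (Fin (finrank ℝ S.horizontal)) ℝ,
      (∑ i, ∑ j, a i j • ⁅(e i : HeisAlg n), (e j : HeisAlg n)⁆) - z ∈ S.horizontal ∧
      s = √(∑ i, ∑ j, a i j ^ 2)}

/-- The basis `b` of the Lie algebra is adapted to the nilpotentization `𝔳 ⊕ (𝔳 + [𝔳, 𝔳]) / 𝔳`: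
the vectors `b i`, `i ∈ I`, form an orthonormal basis of the horizontal space `𝔳`, and the classes
of the others form an orthonormal basis of the quotient for the norm `poppNorm`. -/
structure IsPoppFrame (S : SubRiem n) (b : Basis (HeisAlg.Idx n) ℝ (HeisAlg n))
    (I : Finset (HeisAlg.Idx n)) : Prop where
  span_eq : Submodule.span ℝ (b '' (I : Set (HeisAlg.Idx n))) = S.horizontal
  orthonormal : ∀ i ∈ I, ∀ j ∈ I, ∀ (hi : b i ∈ S.horizontal) (hj : b j ∈ S.horizontal),
    S.inner ⟨b i, hi⟩ ⟨b j, hj⟩ = if i = j then 1 else 0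
  orthonormal_quotient : ∀ a : HeisAlg.Idx n → ℝ,
    S.poppNorm (∑ i ∈ Iᶜ, a i • b i) = √(∑ i ∈ Iᶜ, a i ^ 2)

/-- `v > 0` is, up to sign, the coefficient of Popp's volume form of `S` with respect to
`X₁* ∧ ⋯ ∧ Xₙ* ∧ Y₁* ∧ ⋯ ∧ Yₙ* ∧ Z*`; Popp's volume form is the wedge product of the basis dual to
an adapted frame. -/
def IsPoppVolume (S : SubRiem n) (v : ℝ) : Prop :=
  ∃ (b : Basis (HeisAlg.Idx n) ℝ (HeisAlg n)) (I : Finset (HeisAlg.Idx n)),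
    S.IsPoppFrame b I ∧ v = |(HeisAlg.stdBasis n).det b|⁻¹

/-- The minimal Popp's volume (its coefficient with respect to `X₁* ∧ ⋯ ∧ Z*`): the minimum of
Popp's volumes of the restrictions of the structure to all bracket generating subspaces of the
horizontal space. -/
def minPopp (S : SubRiem n) : ℝ :=
  sInf {v : ℝ | ∃ (W : Submodule ℝ (HeisAlg n)) (hW : W ≤ S.horizontal)
    (hgen : LieSubalgebra.lieSpan ℝ (HeisAlg n) (W : Set (HeisAlg n)) = ⊤),
    (S.restrict W hW hgen).IsPoppVolume v}

/-- The total minimal Popp's volume of `Γ \ Heis n`; `covolume` is the Lebesgue measure of a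
fundamental domain, i.e. the integral of `X₁* ∧ ⋯ ∧ Z*` over the quotient. -/
def totalMinPopp (S : SubRiem n) (Γ : Subgroup (Heis n)) : ℝ≥0∞ :=
  ENNReal.ofReal S.minPopp * covolume Γ (Heis n) volume

end SubRiem

/-- Lattices in `Heis n`: discrete subgroups of finite covolume. -/
structure HeisLattice (n : ℕ) where
  toSubgroup : Subgroup (Heis n)
  discrete : DiscreteTopology toSubgroup
  finite_covolume : ∃ F : Set (Heis n), IsFundamentalDomain toSubgroup F volume ∧ volume F < ⊤

instance {n : ℕ} (Γ : HeisLattice n) : DiscreteTopology Γ.toSubgroup := Γ.discrete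

/-- The compact Heisenberg manifold `Γ \ Heis n`. -/
abbrev HeisLattice.Manifold {n : ℕ} (Γ : HeisLattice n) : Type :=
  MulAction.orbitRel.Quotient Γ.toSubgroup (Heis n)

/-- The tuples `(r₁, …, rₙ)` of positive integers with `rᵢ ∣ rᵢ₊₁`. -/
def IsDivisorChain {n : ℕ} (r : Fin n → ℕ) : Prop :=
  (∀ i, 0 < r i) ∧ ∀ i j : Fin n, i.val + 1 = j.val → r i ∣ r j

/-- The subgroup `Γ_r` generated by `r₁X₁, …, rₙXₙ, Y₁, …, Yₙ, Z`, where the Lie algebra is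
identified with the group by the exponential map. -/
def latticeOf {n : ℕ} (r : Fin n → ℕ) : Subgroup (Heis n) :=
  Subgroup.closure
    (range (fun i : Fin n => HeisAlg.exp ((r i : ℝ) • HeisAlg.stdBasis n (Sum.inl i))) ∪
      range (fun i : Fin n => HeisAlg.exp (HeisAlg.stdBasis n (Sum.inr (Sum.inl i)))) ∪
      {HeisAlg.exp (HeisAlg.stdBasis n (Sum.inr (Sum.inr ())))})

end

/-! The horizontal space contains a complement W of the center along which projection does not
lengthen horizontal vectors: the orthogonal complement of Z if Z is horizontal, the horizontal space
itself otherwise (`exists_complement`). Project an orthonormal basis of W to a basis e of the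
abelianization, and let η be the Hilbert–Schmidt norm of the symplectic form in e. Popp's volume of
W, an upper bound for the minimal one, is 1 / (|det e| η) (`exists_basis_minPopp_le`).

The e-coordinates are 1-Lipschitz along admissible paths, so a diameter at most D means that Γ moves
every point to one with e-coordinates at most R = D + 1. If Γ contains the central element c > 0, a
cylinder of height c over that box meets every orbit, and the covolume is at most |det e| (2R)^(2n)
c. In the product with Popp's volume the determinant cancels, so that V ≤ (2R)^(2n) c / η, i.e. η is
at most a constant times c. The covering also yields elements of Γ whose projections form a real
basis l with bounded e-coordinates. On l the symplectic form is O(η) = O(c)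
(`exists_bounded_family`). Commutators are central, so for c generating the center of Γ the Gram
matrix of l is c M with M integral, bounded and invertible.

By Cramer's rule the projected lattice lies between the span of l and 1 / det M times it. Hence M
and a finite set of points determine the projected lattice up to a conformally symplectic map. Such
a map lifts to an automorphism of the Heisenberg group matching the lattices
(`exists_heisAut_mem_iff`), which gives both the isomorphism and the diffeomorphism
(`HasFrameData.equiv`). For the standard lattices c = 1, and each r i divides det M
(`IsLatticeFrame.dvd_det`), which is bounded. -/

noncomputable section

/-! ### Abelianization, symplectic form and commutators. -/

/-- The projection of the Heisenberg group to its abelianization. -/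
def Heis.proj {n : ℕ} (p : Heis n) : Fin n ⊕ Fin n → ℝ := Sum.elim p.x p.y

/-- The projection of the Heisenberg algebra to its abelianization. -/
def HeisAlg.proj {n : ℕ} : HeisAlg n →ₗ[ℝ] (Fin n ⊕ Fin n → ℝ) where
  toFun u := Sum.elim u.x u.y
  map_add' u v := by ext (i | i) <;> simp
  map_smul' a u := by ext (i | i) <;> simp

/-- The symplectic form on the abelianization. -/
def symplForm (n : ℕ) : LinearMap.BilinForm ℝ (Fin n ⊕ Fin n → ℝ) :=
  LinearMap.mk₂ ℝ (fun u v => sympl (fun i => u (Sum.inl i)) (fun i => u (Sum.inr i))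
      (fun i => v (Sum.inl i)) (fun i => v (Sum.inr i)))
    (fun u u' v => sympl_add_left _ _ _ _ _ _)
    (fun a u v => by
      simp only [sympl, Pi.smul_apply, smul_eq_mul, Finset.mul_sum]
      exact Finset.sum_congr rfl fun i _ => by ring)
    (fun u v v' => sympl_add_right _ _ _ _ _ _)
    (fun a u v => sympl_smul_right _ _ _ _ _)

section Algebra

variable {n : ℕ}

theorem symplForm_apply (u v : Fin n ⊕ Fin n → ℝ) :
    symplForm n u v = ∑ i, (u (Sum.inl i) * v (Sum.inr i) - u (Sum.inr i) * v (Sum.inl i)) := rfl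

theorem symplForm_proj (p q : Heis n) : symplForm n p.proj q.proj = sympl p.x p.y q.x q.y := rfl

theorem symplForm_algProj (u v : HeisAlg n) :
    symplForm n u.proj v.proj = sympl u.x u.y v.x v.y := rfl

theorem symplForm_neg_swap (u v : Fin n ⊕ Fin n → ℝ) : symplForm n u v = -symplForm n v u := by
  simp only [symplForm_apply, ← Finset.sum_neg_distrib]
  exact Finset.sum_congr rfl fun i _ => by ring

theorem symplForm_nondegenerate {u : Fin n ⊕ Fin n → ℝ} (h : ∀ v, symplForm n u v = 0) :
    u = 0 := by
  ext (i | i)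
  · have := h (Pi.single (Sum.inr i) 1)
    simpa [symplForm_apply, Pi.single_apply] using this
  · have := h (Pi.single (Sum.inl i) 1)
    simpa [symplForm_apply, Pi.single_apply] using this

theorem symplForm_ne_zero (hn : 0 < n) : symplForm n ≠ 0 := by
  intro h
  have := symplForm_nondegenerate (n := n) (u := fun _ => 1) (fun v => by simp [h])
  simpa using congrFun this (Sum.inl ⟨0, hn⟩)

namespace Heis

@[simp] theorem proj_mul (p q : Heis n) : (p * q).proj = p.proj + q.proj := by
  ext (i | i) <;> simp [proj]

@[simp] theorem proj_one : (1 : Heis n).proj = 0 := by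
  ext (i | i) <;> simp [proj]

@[simp] theorem proj_inv (p : Heis n) : p⁻¹.proj = -p.proj := by
  ext (i | i) <;> simp [proj]

@[simp] theorem proj_center (z : ℝ) : (mk 0 0 z : Heis n).proj = 0 := by
  ext (i | i) <;> simp [proj]

theorem ext_proj {p q : Heis n} (h : p.proj = q.proj) (hz : p.z = q.z) : p = q :=
  ext' (funext fun i => congrFun h (Sum.inl i)) (funext fun i => congrFun h (Sum.inr i)) hz

/-- The point with given projection and height. -/
def ofProj (v : Fin n ⊕ Fin n → ℝ) (z : ℝ) : Heis n :=
  mk (fun i => v (Sum.inl i)) (fun i => v (Sum.inr i)) z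

@[simp] theorem proj_ofProj (v : Fin n ⊕ Fin n → ℝ) (z : ℝ) : (ofProj v z).proj = v := by
  ext (i | i) <;> rfl

@[simp] theorem z_ofProj (v : Fin n ⊕ Fin n → ℝ) (z : ℝ) : (ofProj v z).z = z := rfl

theorem mul_z' (p q : Heis n) :
    (p * q).z = p.z + q.z + 1 / 2 * symplForm n p.proj q.proj := rfl

theorem eq_center_of_proj_eq_zero {p : Heis n} (h : p.proj = 0) : p = mk 0 0 p.z :=
  ext_proj (by simp [h]) rfl

theorem center_mul (z : ℝ) (p : Heis n) : mk 0 0 z * p = ofProj p.proj (z + p.z) :=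
  ext_proj (by simp) (by simp)

/-- This is the link between a lattice and the symplectic form: values of the form on projected
elements of Γ are heights of central elements of Γ. -/
theorem commutator_eq (p q : Heis n) :
    p * q * p⁻¹ * q⁻¹ = mk 0 0 (symplForm n p.proj q.proj) := by
  refine ext_proj (by simp) ?_
  simp only [mul_z', proj_mul, proj_inv, map_add, map_neg, LinearMap.add_apply, LinearMap.neg_apply,
    inv_z, z_mk]
  rw [symplForm_neg_swap q.proj p.proj, symplForm_neg_swap p.proj p.proj,
    symplForm_neg_swap q.proj q.proj]
  have h1 : symplForm n p.proj p.proj = 0 := sympl_self _ _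
  have h2 : symplForm n q.proj q.proj = 0 := sympl_self _ _
  rw [h1, h2]
  ring

/-- The center of the group as the image of the line. -/
def centerHom (n : ℕ) : Multiplicative ℝ →* Heis n where
  toFun z := mk 0 0 z.toAdd
  map_one' := rfl
  map_mul' a b := ext_proj (by simp) (by simp)

end Heis

namespace HeisAlg

/-- The central vector `Z`. -/
def central (n : ℕ) : HeisAlg n := mk 0 0 1

@[simp] theorem proj_central : (central n).proj = 0 := by
  ext (i | i) <;> simp [proj, central]

@[simp] theorem central_z : (central n).z = 1 := rfl

theorem ext_proj {u v : HeisAlg n} (h : u.proj = v.proj) (hz : u.z = v.z) : u = v :=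
  ext' (funext fun i => congrFun h (Sum.inl i)) (funext fun i => congrFun h (Sum.inr i)) hz

theorem eq_smul_central {u : HeisAlg n} (h : u.proj = 0) : u = u.z • central n :=
  ext_proj (by simp [h]) (by simp [central])

theorem bracket_eq (u v : HeisAlg n) : ⁅u, v⁆ = symplForm n u.proj v.proj • central n :=
  ext_proj (by ext (i | i) <;> simp [proj, central]) (by simp [central, symplForm_algProj])

/-- The vector with given projection and height. -/
def ofProj (v : Fin n ⊕ Fin n → ℝ) (z : ℝ) : HeisAlg n :=
  mk (fun i => v (Sum.inl i)) (fun i => v (Sum.inr i)) z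

@[simp] theorem proj_ofProj (v : Fin n ⊕ Fin n → ℝ) (z : ℝ) : (ofProj v z).proj = v := by
  ext (i | i) <;> rfl

end HeisAlg

end Algebra

end

/-! ### Orthonormal bases and Hilbert–Schmidt norms. -/

section OrthonormalBases

variable {W ι κ : Type*} [AddCommGroup W] [Module ℝ W] [Fintype ι] [Fintype κ]
  [DecidableEq ι] [DecidableEq κ]

/-- Coefficients in an orthonormal basis. -/
theorem repr_eq_of_orthonormal {g : LinearMap.BilinForm ℝ W} {e : Basis ι ℝ W}
    (he : ∀ i j, g (e i) (e j) = if i = j then 1 else 0) (u : W) (i : ι) :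
    e.repr u i = g (e i) u := by
  have h : g (e i) (∑ j, e.repr u j • e j) = e.repr u i := by
    simp only [map_sum, map_smul, smul_eq_mul, he]
    simp
  rw [← h, e.sum_repr]

theorem sum_repr_mul_of_orthonormal {g : LinearMap.BilinForm ℝ W} {e : Basis ι ℝ W}
    (he : ∀ i j, g (e i) (e j) = if i = j then 1 else 0) (φ : W →ₗ[ℝ] ℝ) (u : W) :
    ∑ i, g (e i) u * φ (e i) = φ u := by
  have h : φ (∑ j, e.repr u j • e j) = ∑ i, g (e i) u * φ (e i) := by
    simp only [map_sum, map_smul, smul_eq_mul, repr_eq_of_orthonormal he]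
  rw [← h, e.sum_repr]

theorem inner_self_of_orthonormal {g : LinearMap.BilinForm ℝ W} {e : Basis ι ℝ W}
    (he : ∀ i j, g (e i) (e j) = if i = j then 1 else 0) (u : W) :
    g u u = ∑ i, e.repr u i ^ 2 := by
  have h := sum_repr_mul_of_orthonormal he (g.flip u) u
  refine h.symm.trans (Finset.sum_congr rfl fun i _ => ?_)
  rw [repr_eq_of_orthonormal he, sq]
  rfl

/-- The norm of a linear form does not depend on the orthonormal basis. -/
theorem sum_sq_eq_of_orthonormal {g : LinearMap.BilinForm ℝ W} (hg : ∀ u v, g u v = g v u)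
    {e : Basis ι ℝ W} (he : ∀ i j, g (e i) (e j) = if i = j then 1 else 0)
    {f : Basis κ ℝ W} (hf : ∀ i j, g (f i) (f j) = if i = j then 1 else 0) (φ : W →ₗ[ℝ] ℝ) :
    ∑ i, φ (e i) ^ 2 = ∑ k, φ (f k) ^ 2 := by
  -- Expanding one factor of each square in the other basis turns both sides into the same double
  -- sum.
  have h1 : ∀ i, φ (e i) ^ 2 = ∑ k, g (f k) (e i) * φ (f k) * φ (e i) := fun i => by
    rw [← Finset.sum_mul, sum_repr_mul_of_orthonormal hf, sq]
  have h2 : ∀ k, φ (f k) ^ 2 = ∑ i, g (e i) (f k) * φ (e i) * φ (f k) := fun k => by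
    rw [← Finset.sum_mul, sum_repr_mul_of_orthonormal he, sq]
  simp only [h1, h2]
  rw [Finset.sum_comm]
  refine Finset.sum_congr rfl fun k _ => Finset.sum_congr rfl fun i _ => ?_
  rw [hg]
  ring

/-- The Hilbert–Schmidt norm of a bilinear form does not depend on the orthonormal basis. -/
theorem sum_sum_sq_eq_of_orthonormal {g : LinearMap.BilinForm ℝ W} (hg : ∀ u v, g u v = g v u)
    {e : Basis ι ℝ W} (he : ∀ i j, g (e i) (e j) = if i = j then 1 else 0)
    {f : Basis κ ℝ W} (hf : ∀ i j, g (f i) (f j) = if i = j then 1 else 0)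
    (η : LinearMap.BilinForm ℝ W) :
    ∑ i, ∑ j, η (e i) (e j) ^ 2 = ∑ k, ∑ l, η (f k) (f l) ^ 2 := by
  have h1 : ∀ i, ∑ j, η (e i) (e j) ^ 2 = ∑ l, η (e i) (f l) ^ 2 := fun i =>
    sum_sq_eq_of_orthonormal hg he hf (η (e i))
  have h2 : ∀ l, ∑ i, η (e i) (f l) ^ 2 = ∑ k, η (f k) (f l) ^ 2 := fun l =>
    sum_sq_eq_of_orthonormal hg he hf (η.flip (f l))
  simp only [h1]
  rw [Finset.sum_comm]
  simp only [h2]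
  rw [Finset.sum_comm]

/-- A positive definite symmetric form has an orthonormal basis. -/
theorem exists_orthonormal_basis_of_pos [FiniteDimensional ℝ W] {g : LinearMap.BilinForm ℝ W}
    (hg : ∀ u v, g u v = g v u) (hpos : ∀ u, u ≠ 0 → 0 < g u u)
    (hκ : finrank ℝ W = Fintype.card κ) :
    ∃ f : Basis κ ℝ W, ∀ i j, g (f i) (f j) = if i = j then 1 else 0 := by
  obtain ⟨v, hv⟩ := LinearMap.BilinForm.exists_orthogonal_basis (B := g) ⟨fun u w => hg u w⟩
  have hp : ∀ i, 0 < g (v i) (v i) := fun i => hpos _ (v.ne_zero i)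
  have hs : ∀ i, (√(g (v i) (v i)))⁻¹ ≠ 0 := fun i =>
    inv_ne_zero (Real.sqrt_pos.mpr (hp i)).ne'
  let f := v.isUnitSMul (fun i => (hs i).isUnit)
  let q : Fin (finrank ℝ W) ≃ κ := Fintype.equivOfCardEq (by simp [hκ])
  refine ⟨f.reindex q, fun i j => ?_⟩
  simp only [f, Basis.reindex_apply, Basis.isUnitSMul_apply, map_smul, LinearMap.smul_apply,
    smul_eq_mul]
  rcases eq_or_ne i j with rfl | hij
  · have h0 := (hp (q.symm i)).le
    have h1 := Real.sqrt_pos.mpr (hp (q.symm i))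
    rw [if_pos rfl]
    field_simp
    rw [Real.sq_sqrt h0]
  · have : g (v (q.symm i)) (v (q.symm j)) = 0 := hv (by simpa using hij)
    simp [this, hij]

end OrthonormalBases

/-! ### Complements of the center and Popp's norm. -/

noncomputable section

namespace SubRiem

variable {n : ℕ}

/-- All brackets are central, so W together with the central line is already a Lie subalgebra. -/
theorem sup_central_eq_top {W : Submodule ℝ (HeisAlg n)}
    (hW : LieSubalgebra.lieSpan ℝ (HeisAlg n) (W : Set (HeisAlg n)) = ⊤) :
    W ⊔ Submodule.span ℝ {HeisAlg.central n} = ⊤ := by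
  let K : LieSubalgebra ℝ (HeisAlg n) :=
    { W ⊔ Submodule.span ℝ {HeisAlg.central n} with
      lie_mem' := fun {u v} _ _ => by
        rw [HeisAlg.bracket_eq]
        exact Submodule.mem_sup_right (Submodule.smul_mem _ _ (Submodule.mem_span_singleton_self _)) }
  have h : LieSubalgebra.lieSpan ℝ (HeisAlg n) (W : Set (HeisAlg n)) ≤ K :=
    LieSubalgebra.lieSpan_le.mpr fun u hu => Submodule.mem_sup_left (S := W) hu
  rw [hW] at h
  exact eq_top_iff.mpr fun u _ => h (LieSubalgebra.mem_top u)

/-- A subspace complementary to the center is identified with the abelianization. -/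
theorem bijective_proj_of_isCompl {W : Submodule ℝ (HeisAlg n)} (hZ : HeisAlg.central n ∉ W)
    (hW : W ⊔ Submodule.span ℝ {HeisAlg.central n} = ⊤) :
    Function.Bijective (HeisAlg.proj.domRestrict W) := by
  constructor
  · refine (injective_iff_map_eq_zero _).mpr fun u hu => ?_
    have h1 := HeisAlg.eq_smul_central (u := (u : HeisAlg n)) hu
    by_contra h0
    refine hZ ?_
    have h2 : (u : HeisAlg n).z ≠ 0 := fun h => h0 (Subtype.ext (by rw [h1, h]; simp))
    have h3 : HeisAlg.central n = ((u : HeisAlg n).z)⁻¹ • (u : HeisAlg n) := by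
      conv_rhs => rw [h1, smul_smul]
      simp [h2]
    rw [h3]
    exact W.smul_mem _ u.2
  · intro v
    have : HeisAlg.ofProj v 0 ∈ W ⊔ Submodule.span ℝ {HeisAlg.central n} := hW ▸ Submodule.mem_top
    obtain ⟨w, hw, z, hz, h⟩ := Submodule.mem_sup.mp this
    obtain ⟨a, rfl⟩ := Submodule.mem_span_singleton.mp hz
    refine ⟨⟨w, hw⟩, ?_⟩
    have := congrArg HeisAlg.proj h
    simpa using this

/-- Lifts to W of one pair of conjugate coordinate vectors have bracket Z, whatever their central
components are. -/
theorem generating_of_isCompl (hn : 0 < n) {W : Submodule ℝ (HeisAlg n)}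
    (hZ : HeisAlg.central n ∉ W) (hW : W ⊔ Submodule.span ℝ {HeisAlg.central n} = ⊤) :
    LieSubalgebra.lieSpan ℝ (HeisAlg n) (W : Set (HeisAlg n)) = ⊤ := by
  have hs := (bijective_proj_of_isCompl hZ hW).2
  obtain ⟨u, hu⟩ := hs (Pi.single (Sum.inl ⟨0, hn⟩) 1)
  obtain ⟨v, hv⟩ := hs (Pi.single (Sum.inr ⟨0, hn⟩) 1)
  have hsub := LieSubalgebra.subset_lieSpan (R := ℝ) (L := HeisAlg n) (s := (W : Set (HeisAlg n)))
  have h1 : ⁅(u : HeisAlg n), (v : HeisAlg n)⁆ = HeisAlg.central n := by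
    rw [HeisAlg.bracket_eq, show (u : HeisAlg n).proj = _ from hu,
      show (v : HeisAlg n).proj = _ from hv]
    simp [symplForm_apply, Pi.single_apply]
  have h2 : HeisAlg.central n ∈ LieSubalgebra.lieSpan ℝ (HeisAlg n) (W : Set (HeisAlg n)) :=
    h1 ▸ LieSubalgebra.lie_mem _ (hsub u.2) (hsub v.2)
  have h3 : W ⊔ Submodule.span ℝ {HeisAlg.central n} ≤
      (LieSubalgebra.lieSpan ℝ (HeisAlg n) (W : Set (HeisAlg n))).toSubmodule :=
    sup_le (fun w hw => hsub hw) (Submodule.span_le.mpr (by simpa using h2))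
  rw [hW] at h3
  exact eq_top_iff.mpr fun u _ => h3 Submodule.mem_top

/-- Inside the horizontal space there is a complement of the center such that the projection
along the center does not increase the length of horizontal vectors. -/
theorem exists_complement (S : SubRiem n) :
    ∃ (W : Submodule ℝ (HeisAlg n)) (hW : W ≤ S.horizontal), HeisAlg.central n ∉ W ∧
      W ⊔ Submodule.span ℝ {HeisAlg.central n} = ⊤ ∧
      ∀ u : S.horizontal, ∃ w : W, (w : HeisAlg n).proj = (u : HeisAlg n).proj ∧
        S.inner (Submodule.inclusion hW w) (Submodule.inclusion hW w) ≤ S.inner u u := by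
  have htop := sup_central_eq_top S.generating
  -- If Z is horizontal, the structure is Riemannian and the orthogonal complement of Z works by
  -- Pythagoras. Otherwise the horizontal space is itself a complement.
  by_cases hZ : HeisAlg.central n ∈ S.horizontal
  · have hH : S.horizontal = ⊤ := by
      rwa [sup_eq_left.mpr (Submodule.span_le.mpr (by simpa using hZ))] at htop
    let ζ : S.horizontal := ⟨HeisAlg.central n, hZ⟩
    have hζ : 0 < S.inner ζ ζ := S.pos ζ fun h => by
      have := congrArg (fun u : S.horizontal => (u : HeisAlg n).z) h
      simp [ζ] at this
    have key : ∀ u : S.horizontal, S.inner (u - (S.inner u ζ / S.inner ζ ζ) • ζ) ζ = 0 := by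
      intro u
      simp only [map_sub, map_smul, LinearMap.sub_apply, LinearMap.smul_apply, smul_eq_mul]
      field_simp
      ring
    refine ⟨(LinearMap.ker (S.inner.flip ζ)).map S.horizontal.subtype,
      Submodule.map_subtype_le _ _, ?_, ?_, ?_⟩
    · rintro ⟨u, hu, h⟩
      have : u = ζ := Subtype.ext h
      subst this
      exact hζ.ne' hu
    · refine eq_top_iff.mpr fun u _ => ?_
      let u' : S.horizontal := ⟨u, hH ▸ Submodule.mem_top⟩
      refine Submodule.mem_sup.mpr ⟨_, ⟨u' - (S.inner u' ζ / S.inner ζ ζ) • ζ, key u', rfl⟩,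
        (S.inner u' ζ / S.inner ζ ζ) • HeisAlg.central n,
        Submodule.smul_mem _ _ (Submodule.mem_span_singleton_self _), ?_⟩
      simp [u', ζ]
    · intro u
      refine ⟨⟨_, ⟨u - (S.inner u ζ / S.inner ζ ζ) • ζ, key u, rfl⟩⟩, ?_, ?_⟩
      · simp [ζ]
      · have hk := key u
        set t := S.inner u ζ / S.inner ζ ζ
        set w := u - t • ζ with hw
        have hu : u = w + t • ζ := by simp [hw]
        change S.inner w w ≤ _
        rw [hu]
        simp only [map_add, map_smul, LinearMap.add_apply, LinearMap.smul_apply, smul_eq_mul,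
          S.symm ζ w, hk]
        nlinarith [mul_nonneg (mul_self_nonneg t) hζ.le]
  · exact ⟨S.horizontal, le_rfl, hZ, htop, fun u => ⟨u, rfl, le_rfl⟩⟩

/-- Popp's norm on the quotient by a complement of the center. -/
theorem poppNorm_smul_central {κ : Type*} [Fintype κ] [DecidableEq κ] (S : SubRiem n)
    (hZ : HeisAlg.central n ∉ S.horizontal) (f : Basis κ ℝ S.horizontal)
    (hf : ∀ i j, S.inner (f i) (f j) = if i = j then 1 else 0) {η : ℝ} (hη : 0 < η)
    (hη2 : η ^ 2 = ∑ i, ∑ j, symplForm n (f i : HeisAlg n).proj (f j : HeisAlg n).proj ^ 2)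
    (t : ℝ) : S.poppNorm (t • HeisAlg.central n) = |t| / η := by
  let Ω : LinearMap.BilinForm ℝ S.horizontal :=
    (symplForm n).compl₁₂ (HeisAlg.proj.domRestrict S.horizontal)
      (HeisAlg.proj.domRestrict S.horizontal)
  have hΩ : ∀ u v, Ω u v = symplForm n (u : HeisAlg n).proj (v : HeisAlg n).proj := fun _ _ => rfl
  have : FiniteDimensional ℝ S.horizontal := Module.Finite.of_basis f
  -- `poppNorm` lets the orthonormal basis vary; the Hilbert–Schmidt norm of the bracket does not
  -- see the choice.
  have hsum : ∀ (e : Basis (Fin (finrank ℝ S.horizontal)) ℝ S.horizontal),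
      (∀ i j, S.inner (e i) (e j) = if i = j then 1 else 0) →
      ∑ i, ∑ j, Ω (e i) (e j) ^ 2 = η ^ 2 := fun e he => by
    rw [hη2]
    exact sum_sum_sq_eq_of_orthonormal S.symm he hf Ω
  have hmem : ∀ (e : Basis (Fin (finrank ℝ S.horizontal)) ℝ S.horizontal)
      (a : Matrix (Fin (finrank ℝ S.horizontal)) (Fin (finrank ℝ S.horizontal)) ℝ),
      (∑ i, ∑ j, a i j • ⁅(e i : HeisAlg n), (e j : HeisAlg n)⁆) - t • HeisAlg.central n ∈
        S.horizontal ↔ ∑ i, ∑ j, a i j * Ω (e i) (e j) = t := by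
    intro e a
    have : (∑ i, ∑ j, a i j • ⁅(e i : HeisAlg n), (e j : HeisAlg n)⁆) - t • HeisAlg.central n =
        ((∑ i, ∑ j, a i j * Ω (e i) (e j)) - t) • HeisAlg.central n := by
      simp only [HeisAlg.bracket_eq, hΩ, smul_smul, ← Finset.sum_smul, sub_smul]
    rw [this]
    constructor
    · intro h
      by_contra h0
      have := S.horizontal.smul_mem (∑ i, ∑ j, a i j * Ω (e i) (e j) - t)⁻¹ h
      rw [smul_smul, inv_mul_cancel₀ (sub_ne_zero.mpr h0), one_smul] at this
      exact hZ this
    · rintro rfl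
      simp
  refine IsLeast.csInf_eq ⟨?_, ?_⟩
  · obtain ⟨e, he⟩ := exists_orthonormal_basis_of_pos (κ := Fin (finrank ℝ S.horizontal)) S.symm
      S.pos (by simp)
    -- The minimizer is proportional to Ω, the equality case of the Cauchy–Schwarz inequality that
    -- gives the lower bound below.
    refine ⟨e, he, fun i j => t / η ^ 2 * Ω (e i) (e j), (hmem e _).mpr ?_, ?_⟩
    · simp only [mul_assoc, ← sq, ← Finset.mul_sum]
      rw [hsum e he]
      field_simp
    · simp only [mul_pow, ← Finset.mul_sum]
      rw [hsum e he, show (t / η ^ 2) ^ 2 * η ^ 2 = (t / η) ^ 2 by field_simp, Real.sqrt_sq_eq_abs,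
        abs_div, abs_of_pos hη]
  · rintro s ⟨e, he, a, ha, rfl⟩
    rw [hmem] at ha
    rw [div_le_iff₀ hη]
    have h1 := Finset.sum_mul_sq_le_sq_mul_sq (Finset.univ (α := Fin (finrank ℝ S.horizontal) ×
      Fin (finrank ℝ S.horizontal))) (fun p => a p.1 p.2) (fun p => Ω (e p.1) (e p.2))
    simp only [Fintype.sum_prod_type] at h1
    rw [ha, hsum e he] at h1
    have h2 := Real.sqrt_le_sqrt h1
    rwa [Real.sqrt_sq_eq_abs, Real.sqrt_mul' _ (sq_nonneg _), Real.sqrt_sq hη.le] at h2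

end SubRiem

end

/-! ### Popp's volume of a complement of the center. -/

noncomputable section

namespace SubRiem

variable {n : ℕ}

/-- The identification of the index set of the standard basis with the index set of the
abelianization and one further element. -/
def idxEquiv (n : ℕ) : HeisAlg.Idx n ≃ (Fin n ⊕ Fin n) ⊕ Unit := (Equiv.sumAssoc _ _ _).symm

/-- A lift of a family in the abelianization, completed by a multiple of the central vector. -/
def poppFamily (f : Fin n ⊕ Fin n → HeisAlg n) (η : ℝ) : HeisAlg.Idx n → HeisAlg n :=
  Sum.elim f (fun _ => η • HeisAlg.central n) ∘ idxEquiv n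

theorem stdBasis_repr (u : HeisAlg n) (i : (Fin n ⊕ Fin n) ⊕ Unit) :
    (HeisAlg.stdBasis n).repr u ((idxEquiv n).symm i) = Sum.elim u.proj (fun _ => u.z) i := by
  rcases i with (i | i) | i
  · simp [idxEquiv, HeisAlg.stdBasis, HeisAlg.proj]
    rfl
  · simp [idxEquiv, HeisAlg.stdBasis, HeisAlg.proj]
    rfl
  · simp [idxEquiv, HeisAlg.stdBasis, HeisAlg.proj]
    rfl

/-- Z projects to zero, so the matrix is block triangular and the heights of the lifts drop out. -/
theorem det_poppFamily (f : Fin n ⊕ Fin n → HeisAlg n) (η : ℝ) :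
    (HeisAlg.stdBasis n).det (poppFamily f η) =
      (Pi.basisFun ℝ (Fin n ⊕ Fin n)).det (fun i => (f i).proj) * η := by
  rw [Basis.det_apply, Basis.det_apply,
    ← Matrix.det_submatrix_equiv_self (idxEquiv n).symm ((HeisAlg.stdBasis n).toMatrix _)]
  have : ((HeisAlg.stdBasis n).toMatrix (poppFamily f η)).submatrix (idxEquiv n).symm
      (idxEquiv n).symm = Matrix.fromBlocks
        ((Pi.basisFun ℝ (Fin n ⊕ Fin n)).toMatrix (fun i => (f i).proj)) 0
        (Matrix.of fun _ j => (f j).z) (Matrix.of fun _ _ => η) := by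
    ext i j
    rw [Matrix.submatrix_apply, Basis.toMatrix_apply, stdBasis_repr]
    rcases i with i | i <;> rcases j with j | j <;>
      simp [poppFamily, Matrix.fromBlocks, Basis.toMatrix_apply]
  rw [this, Matrix.det_fromBlocks_zero₁₂]
  simp

/-- Popp's volume of a structure whose horizontal space is a complement of the center. -/
theorem exists_basis_isPoppVolume (hn : 0 < n) (S : SubRiem n)
    (hZ : HeisAlg.central n ∉ S.horizontal) :
    ∃ (e : Basis (Fin n ⊕ Fin n) ℝ (Fin n ⊕ Fin n → ℝ)) (η : ℝ), 0 < η ∧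
      S.IsPoppVolume (|(Pi.basisFun ℝ (Fin n ⊕ Fin n)).det e| * η)⁻¹ ∧
      (∀ i j, |symplForm n (e i) (e j)| ≤ η) ∧
      ∀ (u : S.horizontal) (i : Fin n ⊕ Fin n),
        |e.repr (u : HeisAlg n).proj i| ≤ √(S.inner u u) := by
  let π : S.horizontal ≃ₗ[ℝ] (Fin n ⊕ Fin n → ℝ) :=
    LinearEquiv.ofBijective (HeisAlg.proj.domRestrict S.horizontal)
      (bijective_proj_of_isCompl hZ (sup_central_eq_top S.generating))
  have hπ : ∀ w : S.horizontal, π w = (w : HeisAlg n).proj := fun _ => rfl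
  have : FiniteDimensional ℝ S.horizontal := Module.Finite.equiv π.symm
  obtain ⟨f, hf⟩ := exists_orthonormal_basis_of_pos (κ := Fin n ⊕ Fin n) S.symm S.pos
    (by rw [π.finrank_eq, Module.finrank_fintype_fun_eq_card])
  let e : Basis (Fin n ⊕ Fin n) ℝ (Fin n ⊕ Fin n → ℝ) := f.map π
  -- By `poppNorm_smul_central` this is the scale at which the class of η • Z has Popp norm 1, so
  -- that η • Z completes f to an adapted frame.
  set η := √(∑ i, ∑ j, symplForm n (e i) (e j) ^ 2) with hη
  have hnn : 0 ≤ ∑ i, ∑ j, symplForm n (e i) (e j) ^ 2 :=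
    Finset.sum_nonneg fun i _ => Finset.sum_nonneg fun j _ => sq_nonneg _
  have hη2 : η ^ 2 = ∑ i, ∑ j, symplForm n (e i) (e j) ^ 2 := Real.sq_sqrt hnn
  have habs : ∀ i j, |symplForm n (e i) (e j)| ≤ η := fun i j => by
    refine Real.abs_le_sqrt ?_
    refine (Finset.single_le_sum (f := fun j => symplForm n (e i) (e j) ^ 2)
      (fun j _ => sq_nonneg _) (Finset.mem_univ j)).trans ?_
    exact Finset.single_le_sum (f := fun i => ∑ j, symplForm n (e i) (e j) ^ 2)
      (fun i _ => Finset.sum_nonneg fun j _ => sq_nonneg _) (Finset.mem_univ i)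
  have hη0 : 0 < η := by
    refine (Real.sqrt_nonneg _).lt_of_ne fun h0 => symplForm_ne_zero hn ?_
    refine e.ext fun i => e.ext fun j => ?_
    have := habs i j
    rw [hη, ← h0] at this
    simpa using abs_nonpos_iff.mp this
  have hdet : (HeisAlg.stdBasis n).det (poppFamily (fun i => (f i : HeisAlg n)) η) =
      (Pi.basisFun ℝ (Fin n ⊕ Fin n)).det e * η := det_poppFamily _ _
  have hunit : IsUnit ((Pi.basisFun ℝ (Fin n ⊕ Fin n)).det e) := Basis.isUnit_det _ e
  obtain ⟨hli, hspan⟩ := (Basis.is_basis_iff_det (HeisAlg.stdBasis n)).mpr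
    (hdet ▸ hunit.mul hη0.ne'.isUnit :
      IsUnit ((HeisAlg.stdBasis n).det (poppFamily (fun i => (f i : HeisAlg n)) η)))
  let b : Basis (HeisAlg.Idx n) ℝ (HeisAlg n) := Basis.mk hli hspan.ge
  have hb : ∀ i, b i = poppFamily (fun i => (f i : HeisAlg n)) η i := fun i => by
    simp [b]
  have hbl : ∀ i, b ((idxEquiv n).symm (Sum.inl i)) = (f i : HeisAlg n) := fun i => by
    simp [hb, poppFamily]
  let I : Finset (HeisAlg.Idx n) := Finset.univ.image fun i => (idxEquiv n).symm (Sum.inl i)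
  have hI : Iᶜ = {(idxEquiv n).symm (Sum.inr ())} := by
    ext j
    obtain ⟨j, rfl⟩ := (idxEquiv n).symm.surjective j
    rcases j with j | j <;> simp [I]
  have hframe : S.IsPoppFrame b I := by
    refine ⟨?_, ?_, ?_⟩
    · have h1 : b '' (I : Set (HeisAlg.Idx n)) = S.horizontal.subtype '' range f := by
        rw [Finset.coe_image, Finset.coe_univ, image_univ, ← range_comp, ← range_comp]
        exact congrArg range (funext hbl)
      rw [h1, Submodule.span_image, f.span_eq, Submodule.map_subtype_top]
    · intro i hi j hj h1 h2
      simp only [I, Finset.mem_image, Finset.mem_univ, true_and] at hi hj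
      obtain ⟨i, rfl⟩ := hi
      obtain ⟨j, rfl⟩ := hj
      have e1 : (⟨_, h1⟩ : S.horizontal) = f i := Subtype.ext (hbl i)
      have e2 : (⟨_, h2⟩ : S.horizontal) = f j := Subtype.ext (hbl j)
      rw [e1, e2, hf]
      simp
    · intro a
      rw [hI, Finset.sum_singleton, Finset.sum_singleton, hb]
      simp only [poppFamily, Function.comp_apply, Equiv.apply_symm_apply, Sum.elim_inr, smul_smul]
      rw [S.poppNorm_smul_central hZ f hf hη0 hη2, abs_mul, abs_of_pos hη0,
        mul_div_cancel_right₀ _ hη0.ne', Real.sqrt_sq_eq_abs]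
  refine ⟨e, η, hη0, ⟨b, I, hframe, ?_⟩, habs, ?_⟩
  · rw [show (b : HeisAlg.Idx n → HeisAlg n) = _ from funext hb, hdet, abs_mul, abs_of_pos hη0]
  · intro u i
    have h1 : e.repr (u : HeisAlg n).proj i = f.repr u i := by
      rw [← hπ]
      simp [e]
    rw [h1, inner_self_of_orthonormal hf u]
    refine Real.abs_le_sqrt ?_
    exact Finset.single_le_sum (f := fun i => f.repr u i ^ 2) (fun j _ => sq_nonneg _)
      (Finset.mem_univ i)

/-- An upper bound of the minimal Popp's volume by Popp's volume of a complement of the center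
along which the projection does not increase lengths. -/
theorem exists_basis_minPopp_le (hn : 0 < n) (S : SubRiem n) :
    ∃ (e : Basis (Fin n ⊕ Fin n) ℝ (Fin n ⊕ Fin n → ℝ)) (η : ℝ), 0 < η ∧
      S.minPopp ≤ (|(Pi.basisFun ℝ (Fin n ⊕ Fin n)).det e| * η)⁻¹ ∧
      (∀ i j, |symplForm n (e i) (e j)| ≤ η) ∧
      ∀ (u : S.horizontal) (i : Fin n ⊕ Fin n),
        |e.repr (u : HeisAlg n).proj i| ≤ √(S.inner u u) := by
  obtain ⟨W, hW, hZ, htop, hle⟩ := S.exists_complement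
  have hgen := generating_of_isCompl hn hZ htop
  obtain ⟨e, η, hη, hvol, habs, hlen⟩ := exists_basis_isPoppVolume hn (S.restrict W hW hgen) hZ
  refine ⟨e, η, hη, csInf_le ⟨0, ?_⟩ ⟨W, hW, hgen, hvol⟩, habs, fun u i => ?_⟩
  · rintro v ⟨_, _, _, _, _, _, rfl⟩
    positivity
  · obtain ⟨w, hw, hwu⟩ := hle u
    rw [← hw]
    exact (hlen w i).trans (Real.sqrt_le_sqrt hwu)

end SubRiem

end

/-! ### Lengths of admissible paths and the covering property. -/

noncomputable section

section Paths

theorem LipschitzWith.comp_absolutelyContinuousOnInterval {X Y : Type*} [PseudoMetricSpace X]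
    [PseudoMetricSpace Y] {K : NNReal} {g : X → Y} (hg : LipschitzWith K g) {f : ℝ → X} {a b : ℝ}
    (hf : AbsolutelyContinuousOnInterval f a b) :
    AbsolutelyContinuousOnInterval (g ∘ f) a b := by
  refine squeeze_zero (fun E => Finset.sum_nonneg fun i _ => dist_nonneg) (fun E => ?_)
    (by simpa using Filter.Tendsto.const_mul (K : ℝ) hf)
  rw [Finset.mul_sum]
  exact Finset.sum_le_sum fun i _ => hg.dist_le_mul _ _

variable {n : ℕ}

/-- The identification of the coordinate space with a product, as a continuous linear map. -/
def Heis.coordCLM (n : ℕ) : Heis n ≃L[ℝ] (Fin n → ℝ) × (Fin n → ℝ) × ℝ :=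
  ContinuousLinearEquiv.refl ℝ ((Fin n → ℝ) × (Fin n → ℝ) × ℝ)

/-- The projection to the abelianization, as a continuous linear map. -/
def Heis.projCLM (n : ℕ) : Heis n →L[ℝ] (Fin n ⊕ Fin n → ℝ) where
  toFun := Heis.proj
  map_add' u v := by ext (i | i) <;> rfl
  map_smul' a u := by ext (i | i) <;> rfl
  cont := by
    refine continuous_pi fun i => ?_
    rcases i with i | i
    · exact (continuous_apply i).comp Heis.continuous_x
    · exact (continuous_apply i).comp Heis.continuous_y

/-- `deriv` takes the default value 0 where c is not differentiable, so this is needed to move a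
linear form past it. Scalar absolutely continuous functions are differentiable almost everywhere;
this is applied to each coordinate. -/
theorem Heis.ae_differentiableAt {c : ℝ → Heis n} (hc : AbsolutelyContinuousOnInterval c 0 1) :
    ∀ᵐ t ∂(volume.restrict (Icc (0 : ℝ) 1)), DifferentiableAt ℝ c t := by
  rw [ae_restrict_iff' measurableSet_Icc]
  have key : ∀ φ : Heis n →L[ℝ] ℝ, ∀ᵐ t, t ∈ Icc (0 : ℝ) 1 → DifferentiableAt ℝ (φ ∘ c) t := by
    intro φ
    have := (φ.lipschitz.comp_absolutelyContinuousOnInterval hc).ae_differentiableAt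
    simpa [uIcc_of_le] using this
  let π : Heis n →L[ℝ] (Fin n → ℝ) × (Fin n → ℝ) × ℝ := Heis.coordCLM n
  let q : (i : Fin n) → (Fin n → ℝ) →L[ℝ] ℝ := ContinuousLinearMap.proj
  have hx : ∀ᵐ t, ∀ i : Fin n, t ∈ Icc (0 : ℝ) 1 → DifferentiableAt ℝ (fun s => (c s).x i) t :=
    ae_all_iff.mpr fun i => key ((q i).comp ((ContinuousLinearMap.fst ℝ _ _).comp π))
  have hy : ∀ᵐ t, ∀ i : Fin n, t ∈ Icc (0 : ℝ) 1 → DifferentiableAt ℝ (fun s => (c s).y i) t :=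
    ae_all_iff.mpr fun i => key ((q i).comp
      ((ContinuousLinearMap.fst ℝ _ _).comp ((ContinuousLinearMap.snd ℝ _ _).comp π)))
  have hz : ∀ᵐ t, t ∈ Icc (0 : ℝ) 1 → DifferentiableAt ℝ (fun s => (c s).z) t :=
    key ((ContinuousLinearMap.snd ℝ _ _).comp ((ContinuousLinearMap.snd ℝ _ _).comp π))
  filter_upwards [hx, hy, hz] with t h1 h2 h3 ht
  have : DifferentiableAt ℝ (fun s => ((c s).x, (c s).y, (c s).z)) t :=
    (differentiableAt_pi.mpr fun i => h1 i ht).prodMk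
      ((differentiableAt_pi.mpr fun i => h2 i ht).prodMk (h3 ht))
  exact ((Heis.coordCLM n).symm.differentiableAt (x := Heis.coordCLM n (c t))).comp t this

/-- A linear form on the abelianization that is bounded by the length on horizontal vectors does
not vary along an admissible path by more than the length of the path. -/
theorem SubRiem.ofReal_abs_sub_le_length {S : SubRiem n} {φ : (Fin n ⊕ Fin n → ℝ) →ₗ[ℝ] ℝ}
    (hφ : ∀ u : S.horizontal, |φ (u : HeisAlg n).proj| ≤ √(S.inner u u)) {c : ℝ → Heis n}
    (hc : S.IsAdmissible c) :
    ENNReal.ofReal |φ (c 1).proj - φ (c 0).proj| ≤ S.length c := by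
  let ψ : Heis n →L[ℝ] ℝ := φ.toContinuousLinearMap.comp (Heis.projCLM n)
  have hψ : ∀ p, ψ p = φ p.proj := fun _ => rfl
  have hac : AbsolutelyContinuousOnInterval (ψ ∘ c) 0 1 :=
    ψ.lipschitz.comp_absolutelyContinuousOnInterval hc.1
  have h1 : φ (c 1).proj - φ (c 0).proj = ∫ t in Icc (0 : ℝ) 1, deriv (ψ ∘ c) t := by
    rw [integral_Icc_eq_integral_Ioc, ← intervalIntegral.integral_of_le zero_le_one,
      hac.integral_deriv_eq_sub]
    rfl
  rw [h1, ← Real.enorm_eq_ofReal_abs]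
  refine (enorm_integral_le_lintegral_enorm _).trans (lintegral_mono_ae ?_)
  filter_upwards [Heis.ae_differentiableAt hc.1, hc.2] with t hd hh
  have h2 : deriv (ψ ∘ c) t = ψ (deriv c t) :=
    (ψ.hasFDerivAt.comp_hasDerivAt t hd.hasDerivAt).deriv
  rw [SubRiem.speed, dif_pos hh, h2, hψ, Real.enorm_eq_ofReal_abs]
  -- Left trivialization changes only the central component of the velocity, so both projections
  -- agree by definition.
  exact ENNReal.ofReal_le_ofReal (hφ ⟨leftVelocity c t, hh⟩)

/-- If the quotient has bounded diameter, then every point can be moved by the group to a point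
whose projection is bounded. -/
theorem SubRiem.exists_mem_abs_le {S : SubRiem n} {Γ : Subgroup (Heis n)} {D : ℝ} (hD : 0 ≤ D)
    (hdiam : S.diam Γ ≤ ENNReal.ofReal D) {ι : Type*}
    {φ : ι → (Fin n ⊕ Fin n → ℝ) →ₗ[ℝ] ℝ}
    (hφ : ∀ (u : S.horizontal) (i : ι), |φ i (u : HeisAlg n).proj| ≤ √(S.inner u u))
    (p : Heis n) : ∃ γ ∈ Γ, ∀ i, |φ i (γ * p).proj| ≤ D + 1 := by
  -- The infimum defining the distance need not be attained; the margin D + 1 makes the inequality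
  -- strict and provides a path. It runs from some a in Γ to b * p with b in Γ.
  have h1 : S.quotDist Γ (Quotient.mk (MulAction.orbitRel Γ (Heis n)) 1)
      (Quotient.mk (MulAction.orbitRel Γ (Heis n)) p) < ENNReal.ofReal (D + 1) := by
    refine lt_of_le_of_lt (le_trans ?_ hdiam)
      ((ENNReal.ofReal_lt_ofReal_iff (by linarith)).mpr (by linarith))
    exact le_iSup₂_of_le (f := fun p q => S.quotDist Γ p q) _ _ le_rfl
  simp only [quotDist, iInf_lt_iff] at h1
  obtain ⟨c, hc, h0, h1, hlen⟩ := h1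
  obtain ⟨⟨a, ha⟩, ha'⟩ := Quotient.exact h0
  obtain ⟨⟨b, hb⟩, hb'⟩ := Quotient.exact h1
  have ha1 : c 0 = a := by rw [← ha']; exact mul_one a
  have hb1 : c 1 = b * p := hb'.symm
  refine ⟨a⁻¹ * b, Γ.mul_mem (Γ.inv_mem ha) hb, fun i => ?_⟩
  have h2 := (SubRiem.ofReal_abs_sub_le_length (fun u => hφ u i) hc).trans hlen.le
  rw [ENNReal.ofReal_le_ofReal_iff (by linarith), ha1, hb1, ← map_sub] at h2
  convert h2 using 3
  simp
  abel

end Paths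

end

/-! ### Independent lattice elements with bounded projection. -/

noncomputable section

section Covering

variable {n : ℕ}

/-- A subgroup that moves every point to a point with bounded projection contains elements with
linearly independent bounded projections. -/
theorem exists_linearIndependent_of_covering {Γ : Subgroup (Heis n)}
    (e : Basis (Fin n ⊕ Fin n) ℝ (Fin n ⊕ Fin n → ℝ)) {R : ℝ} (hR : 0 < R)
    (hcov : ∀ p : Heis n, ∃ γ ∈ Γ, ∀ i, |e.repr (γ * p).proj i| ≤ R) :
    ∃ γ : Fin n ⊕ Fin n → Heis n, (∀ i, γ i ∈ Γ) ∧
      LinearIndependent ℝ (fun i => (γ i).proj) ∧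
      ∀ i j, |e.repr (γ i).proj j| ≤ (2 * n + 2) * R := by
  -- The projection of γ i is then within R of (2n + 1) R e i in each coordinate: the diagonal entry
  -- is at least 2nR, while the 2n - 1 others add up to at most (2n - 1) R. Diagonal dominance gives
  -- independence.
  choose γ hγ hle using fun i => hcov (Heis.ofProj (-((2 * n + 1) * R) • e i) 0)
  have h1 : ∀ i j, |e.repr (γ i).proj j - (if i = j then (2 * n + 1) * R else 0)| ≤ R := by
    intro i j
    have := hle i j
    simp only [Heis.proj_mul, Heis.proj_ofProj, map_add, map_smul, Finsupp.add_apply,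
      Finsupp.smul_apply, Basis.repr_self, Finsupp.single_apply, smul_eq_mul, mul_ite, mul_one,
      mul_zero] at this
    convert this using 2
    split_ifs <;> ring
  have hdiag : ∀ i, 2 * n * R ≤ |e.repr (γ i).proj i| := fun i => by
    have := h1 i i
    rw [if_pos rfl] at this
    have h2 := (abs_le.mp this).1
    exact le_trans (by linarith) (le_abs_self _)
  have hoff : ∀ i j, i ≠ j → |e.repr (γ i).proj j| ≤ R := fun i j hij => by
    have := h1 i j
    rwa [if_neg hij, sub_zero] at this
  refine ⟨γ, hγ, ?_, fun i j => ?_⟩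
  · have hdet : (Matrix.of fun i j => e.repr (γ i).proj j).det ≠ 0 := by
      refine det_ne_zero_of_sum_row_lt_diag fun k => ?_
      simp only [Matrix.of_apply, Real.norm_eq_abs]
      calc ∑ j ∈ Finset.univ.erase k, |e.repr (γ k).proj j|
          ≤ ∑ _j ∈ Finset.univ.erase k, R :=
            Finset.sum_le_sum fun j hj => hoff k j (Finset.ne_of_mem_erase hj).symm
        _ = (2 * n - 1) * R := by
            have : 0 < Fintype.card (Fin n ⊕ Fin n) := Fintype.card_pos_iff.mpr ⟨k⟩
            rw [Finset.sum_const, Finset.card_erase_of_mem (Finset.mem_univ k), Finset.card_univ,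
              nsmul_eq_mul, Nat.cast_sub this, Fintype.card_sum, Fintype.card_fin]
            push_cast
            ring
        _ < 2 * n * R := by linarith
        _ ≤ _ := hdiag k
    have hli := Matrix.linearIndependent_rows_of_det_ne_zero hdet
    exact LinearIndependent.of_comp e.equivFun.toLinearMap hli
  · rcases eq_or_ne i j with rfl | hij
    · have := h1 i i
      rw [if_pos rfl] at this
      have h2 := abs_sub_abs_le_abs_sub (e.repr (γ i).proj i) ((2 * n + 1) * R)
      rw [abs_of_nonneg (by positivity : 0 ≤ (2 * n + 1) * R)] at h2
      linarith
    · have : 0 ≤ (2 * n + 1) * R := by positivity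
      linarith [hoff i j hij]

theorem abs_bilin_le {κ V : Type*} [Fintype κ] [AddCommGroup V] [Module ℝ V] (e : Basis κ ℝ V)
    (B : LinearMap.BilinForm ℝ V) {η ρ : ℝ} (hρ : 0 ≤ ρ)
    (hB : ∀ i j, |B (e i) (e j)| ≤ η) {u v : V} (hu : ∀ i, |e.repr u i| ≤ ρ)
    (hv : ∀ i, |e.repr v i| ≤ ρ) : |B u v| ≤ (Fintype.card κ : ℝ) ^ 2 * ρ ^ 2 * η := by
  have h : B u v = ∑ i, ∑ j, e.repr u i * (e.repr v j * B (e i) (e j)) := by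
    conv_lhs => rw [← e.sum_repr u, ← e.sum_repr v]
    simp only [map_sum, LinearMap.sum_apply, map_smul, LinearMap.smul_apply, smul_eq_mul,
      Finset.mul_sum]
    rw [Finset.sum_comm]
    refine Finset.sum_congr rfl fun i _ => Finset.sum_congr rfl fun j _ => by ring
  rw [h]
  have hterm : ∀ i j, |e.repr u i * (e.repr v j * B (e i) (e j))| ≤ ρ * (ρ * η) := fun i j => by
    rw [abs_mul, abs_mul]
    gcongr
    exacts [hu i, hv j, hB i j]
  calc _ ≤ ∑ i, ∑ j, |e.repr u i * (e.repr v j * B (e i) (e j))| :=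
        (Finset.abs_sum_le_sum_abs _ _).trans
          (Finset.sum_le_sum fun i _ => Finset.abs_sum_le_sum_abs _ _)
    _ ≤ ∑ _i : κ, ∑ _j : κ, ρ * (ρ * η) :=
        Finset.sum_le_sum fun i _ => Finset.sum_le_sum fun j _ => hterm i j
    _ = _ := by simp; ring

end Covering

/-! ### Upper bound of the covolume. -/

section Volume

open scoped Pointwise

variable {n : ℕ}

/-- Left translation shifts x and y by constants and z by an amount depending only on x and y, so
invariance reduces to that of Lebesgue measure under translations, one factor at a time. -/
theorem Heis.measurePreserving_mul_left (g : Heis n) :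
    MeasurePreserving (fun p : Heis n => g * p) := by
  let F : (Fin n → ℝ) → ((Fin n → ℝ) × ℝ) → ((Fin n → ℝ) × ℝ) := fun x q =>
    (g.y + q.1, g.z + q.2 + 1 / 2 * sympl g.x g.y x q.1)
  have hsy : Measurable fun q : (Fin n → ℝ) × (Fin n → ℝ) => sympl g.x g.y q.1 q.2 := by
    unfold sympl
    fun_prop
  have hF : ∀ x, MeasurePreserving (F x) volume volume := by
    intro x
    refine MeasurePreserving.skew_product (μa := (volume : Measure (Fin n → ℝ)))
      (μc := (volume : Measure ℝ)) (μd := (volume : Measure ℝ)) (f := fun y => g.y + y)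
      (g := fun y z => g.z + z + 1 / 2 * sympl g.x g.y x y)
      (measurePreserving_add_left volume g.y) ?_ (Filter.Eventually.of_forall fun y => ?_)
    · have h1 : Measurable fun q : (Fin n → ℝ) × ℝ => sympl g.x g.y x q.1 :=
        hsy.comp (measurable_const.prodMk measurable_fst)
      exact (measurable_const.add measurable_snd).add (measurable_const.mul h1)
    · have : (fun z => g.z + z + 1 / 2 * sympl g.x g.y x y) =
          fun z => (g.z + 1 / 2 * sympl g.x g.y x y) + z := by
        ext z; ring
      rw [this]
      exact (measurePreserving_add_left volume _).map_eq
  refine MeasurePreserving.skew_product (μa := (volume : Measure (Fin n → ℝ)))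
      (μc := (volume : Measure ((Fin n → ℝ) × ℝ))) (μd := (volume : Measure ((Fin n → ℝ) × ℝ)))
      (f := fun x => g.x + x) (g := F)
      (measurePreserving_add_left volume g.x) ?_ (Filter.Eventually.of_forall fun x => (hF x).map_eq)
  refine (measurable_const.add (measurable_fst.comp measurable_snd)).prodMk
    ((measurable_const.add (measurable_snd.comp measurable_snd)).add (measurable_const.mul ?_))
  exact hsy.comp (measurable_fst.prodMk (measurable_fst.comp measurable_snd))

instance (Γ : Subgroup (Heis n)) : SMulInvariantMeasure Γ (Heis n) volume where
  measure_preimage_smul g _ hs :=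
    (Heis.measurePreserving_mul_left (g : Heis n)).measure_preimage hs.nullMeasurableSet

instance (Γ : Subgroup (Heis n)) : MeasurableConstSMul Γ (Heis n) where
  measurable_const_smul g := (Heis.measurePreserving_mul_left (g : Heis n)).measurable

/-- The pieces g • t ∩ s have total measure μ t and cover s. -/
theorem MeasureTheory.IsFundamentalDomain.measure_le_of_covering {G α : Type*} [Group G]
    [MulAction G α] [MeasurableSpace α] {μ : Measure α} [MeasurableConstSMul G α]
    [SMulInvariantMeasure G α μ] [Countable G] {s t : Set α} (h : IsFundamentalDomain G s μ)
    (ht : ∀ x, ∃ g : G, g • x ∈ t) : μ s ≤ μ t := by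
  rw [h.measure_eq_tsum t]
  refine (measure_mono fun x hx => ?_).trans (measure_iUnion_le fun g : G => g • t ∩ s)
  obtain ⟨g, hg⟩ := ht x
  exact mem_iUnion.mpr ⟨g⁻¹, mem_smul_set_iff_inv_smul_mem.mpr (by simpa using hg), hx⟩

theorem MeasureTheory.covolume_le_of_covering {G α : Type*} [Group G]
    [MulAction G α] [MeasurableSpace α] {μ : Measure α} [MeasurableConstSMul G α]
    [SMulInvariantMeasure G α μ] [Countable G] {t : Set α}
    (ht : ∀ x, ∃ g : G, g • x ∈ t) : covolume G α μ ≤ μ t := by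
  unfold covolume
  split_ifs with h
  · exact h.ExistsIsFundamentalDomain.choose_spec.measure_le_of_covering ht
  -- Without a fundamental domain `covolume` is 0 by convention.
  · exact zero_le

/-- The volume of a cylinder over a parallelepiped. -/
theorem Heis.volume_cylinder_le (e : Basis (Fin n ⊕ Fin n) ℝ (Fin n ⊕ Fin n → ℝ)) {R : ℝ}
    (hR : 0 ≤ R) (c : ℝ) :
    volume {p : Heis n | (∀ i, |e.repr p.proj i| ≤ R) ∧ p.z ∈ Ico 0 c} ≤
      ENNReal.ofReal (|(Pi.basisFun ℝ (Fin n ⊕ Fin n)).det e| * (2 * R) ^ (2 * n) * c) := by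
  let A : Set (Fin n ⊕ Fin n → ℝ) := {v | ∀ i, |e.repr v i| ≤ R}
  have hA : volume A = ENNReal.ofReal (|(Pi.basisFun ℝ (Fin n ⊕ Fin n)).det e| *
      (2 * R) ^ (2 * n)) := by
    let T : (Fin n ⊕ Fin n → ℝ) →ₗ[ℝ] (Fin n ⊕ Fin n → ℝ) :=
      (Pi.basisFun ℝ (Fin n ⊕ Fin n)).constr ℝ e
    have hT : ∀ t, T t = e.equivFun.symm t := fun t => by
      simp [T, Basis.constr_apply_fintype, Basis.equivFun_symm_apply]
    have h1 : A = T '' Set.pi univ fun _ => Icc (-R) R := by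
      ext v
      constructor
      · intro hv
        exact ⟨e.equivFun v, fun i _ => abs_le.mp (hv i), by rw [hT]; simp⟩
      · rintro ⟨t, ht, rfl⟩ i
        rw [hT]
        have := abs_le.mpr (ht i (mem_univ i))
        rwa [show e.repr (e.equivFun.symm t) i = t i from
          congrFun (e.equivFun.apply_symm_apply t) i]
    have h2 : LinearMap.det T = (Pi.basisFun ℝ (Fin n ⊕ Fin n)).det e := by
      rw [← LinearMap.det_toMatrix (Pi.basisFun ℝ (Fin n ⊕ Fin n)), Basis.det_apply]
      congr 1
      ext i j
      simp only [T, LinearMap.toMatrix_apply, Basis.toMatrix_apply, Basis.constr_basis]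
    rw [h1, Measure.addHaar_image_linearMap, h2, volume_pi_pi, ENNReal.ofReal_mul (abs_nonneg _)]
    congr 1
    simp only [Real.volume_Icc, Finset.prod_const, Finset.card_univ, Fintype.card_sum,
      Fintype.card_fin]
    rw [← ENNReal.ofReal_pow (by linarith)]
    congr 2 <;> ring
  have hmeas : MeasurePreserving (fun q : (Fin n ⊕ Fin n → ℝ) × ℝ => Heis.ofProj q.1 q.2)
      volume volume := by
    have h1 : MeasurePreserving (Prod.map (MeasurableEquiv.sumPiEquivProdPi
        (fun _ : Fin n ⊕ Fin n => ℝ)) (id : ℝ → ℝ)) (volume.prod volume) (volume.prod volume) :=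
      (volume_measurePreserving_sumPiEquivProdPi (fun _ : Fin n ⊕ Fin n => ℝ)).prod
        (MeasurePreserving.id volume)
    exact (volume_preserving_prodAssoc (α₁ := Fin n → ℝ) (β₁ := Fin n → ℝ) (γ₁ := ℝ)).comp h1
  have hsub : (fun q : (Fin n ⊕ Fin n → ℝ) × ℝ => Heis.ofProj q.1 q.2) ⁻¹'
      {p : Heis n | (∀ i, |e.repr p.proj i| ≤ R) ∧ p.z ∈ Ico 0 c} = A ×ˢ Ico 0 c := by
    ext q
    simp [A]
  have hmeasurable : MeasurableSet
      {p : Heis n | (∀ i, |e.repr p.proj i| ≤ R) ∧ p.z ∈ Ico 0 c} := by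
    have : {p : Heis n | ∀ i, |e.repr p.proj i| ≤ R} = ⋂ i, {p : Heis n | |e.repr p.proj i| ≤ R} := by
      ext p; simp
    refine MeasurableSet.inter (s₁ := {p : Heis n | ∀ i, |e.repr p.proj i| ≤ R}) ?_
      (Heis.continuous_z.measurable measurableSet_Ico)
    rw [this]
    refine MeasurableSet.iInter fun i => IsClosed.measurableSet (isClosed_le ?_ continuous_const)
    exact continuous_abs.comp ((e.coord i).continuous_of_finiteDimensional.comp
      (Heis.projCLM n).continuous)
  rw [← hmeas.measure_preimage hmeasurable.nullMeasurableSet, hsub]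
  rw [Measure.volume_eq_prod, Measure.prod_prod, hA, Real.volume_Ico, sub_zero]
  exact (ENNReal.ofReal_mul (by positivity)).ge

/-- An element of Γ brings the projection into the box; a power of the central element then brings
the height into [0, c) without moving the projection. -/
theorem Heis.covolume_le {Γ : Subgroup (Heis n)} [Countable Γ]
    (e : Basis (Fin n ⊕ Fin n) ℝ (Fin n ⊕ Fin n → ℝ)) {R : ℝ} (hR : 0 ≤ R)
    (hcov : ∀ p : Heis n, ∃ γ ∈ Γ, ∀ i, |e.repr (γ * p).proj i| ≤ R) {c : ℝ} (hc : 0 < c)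
    (hcΓ : Heis.mk 0 0 c ∈ Γ) :
    covolume Γ (Heis n) volume ≤
      ENNReal.ofReal (|(Pi.basisFun ℝ (Fin n ⊕ Fin n)).det e| * (2 * R) ^ (2 * n) * c) := by
  refine (covolume_le_of_covering fun p => ?_).trans (Heis.volume_cylinder_le e hR c)
  obtain ⟨γ, hγ, hle⟩ := hcov p
  obtain ⟨k, hk, -⟩ := existsUnique_add_zsmul_mem_Ico hc (γ * p).z 0
  have hpow : ∀ k : ℤ, (Heis.mk 0 0 c : Heis n) ^ k = Heis.mk 0 0 (k * c) := fun k => by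
    have := map_zpow (Heis.centerHom n) (Multiplicative.ofAdd c) k
    rw [← ofAdd_zsmul] at this
    simpa [Heis.centerHom] using this.symm
  refine ⟨⟨Heis.mk 0 0 (k * c) * γ, Γ.mul_mem (hpow k ▸ Γ.zpow_mem hcΓ k) hγ⟩, ?_⟩
  change (∀ i, |e.repr (Heis.mk 0 0 (k * c) * γ * p).proj i| ≤ R) ∧
    (Heis.mk 0 0 (k * c) * γ * p).z ∈ Ico 0 c
  rw [mul_assoc, Heis.center_mul]
  refine ⟨by simpa using hle, ?_⟩
  simpa [add_comm] using hk

end Volume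

end

/-! ### Bounded Gram matrices and the center of a lattice. -/

noncomputable section

section Bounds

variable {n : ℕ}

/-- Bounded diameter and volume bounded from below give linearly independent elements of the
projected lattice on which the symplectic form is bounded by the size of the center. -/
theorem exists_bounded_family (hn : 0 < n) {D V : ℝ} (hD : 0 < D) (hV : 0 < V) :
    ∃ B : ℕ, ∀ (Γ : Subgroup (Heis n)) [Countable Γ] (S : SubRiem n),
      S.diam Γ ≤ ENNReal.ofReal D → ENNReal.ofReal V ≤ S.totalMinPopp Γ →
      ∃ (γ : Fin n ⊕ Fin n → Heis n) (l : Basis (Fin n ⊕ Fin n) ℝ (Fin n ⊕ Fin n → ℝ)),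
        (∀ i, γ i ∈ Γ) ∧ (∀ i, (γ i).proj = l i) ∧
        ∀ c : ℝ, 0 < c → Heis.mk 0 0 c ∈ Γ →
          ∀ i j, |symplForm n (l i) (l j)| ≤ B * c := by
  set R := D + 1
  have hR : 0 < R := by positivity
  set K := (Fintype.card (Fin n ⊕ Fin n) : ℝ) ^ 2 * ((2 * n + 2) * R) ^ 2
  have hK0 : 0 ≤ K := by positivity
  -- K η bounds the form on the chosen elements by `abs_bilin_le`, and (2R)^(2n) / V is the ratio of
  -- η to c permitted by the volume.
  obtain ⟨B, hB⟩ := exists_nat_ge (K * ((2 * R) ^ (2 * n) / V))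
  refine ⟨B, fun Γ _ S hdiam hvol => ?_⟩
  obtain ⟨e, η, hη, hpopp, hform, hlen⟩ := S.exists_basis_minPopp_le hn
  have hcov : ∀ p : Heis n, ∃ γ ∈ Γ, ∀ i, |e.repr (γ * p).proj i| ≤ R := fun p =>
    SubRiem.exists_mem_abs_le hD.le hdiam (φ := fun i => e.coord i) hlen p
  obtain ⟨γ, hγ, hli, hle⟩ := exists_linearIndependent_of_covering e hR hcov
  have : Nonempty (Fin n ⊕ Fin n) := ⟨Sum.inl ⟨0, hn⟩⟩
  let l := basisOfLinearIndependentOfCardEqFinrank hli (by simp)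
  have hl : ∀ i, l i = (γ i).proj := fun i => by simp [l]
  refine ⟨γ, l, hγ, fun i => (hl i).symm, fun c hc hcΓ i j => ?_⟩
  rw [hl, hl]
  -- The determinant of e cancels between Popp's volume and the covolume.
  have h1 : ENNReal.ofReal V ≤ ENNReal.ofReal ((2 * R) ^ (2 * n) * c / η) := by
    refine hvol.trans ((mul_le_mul' (ENNReal.ofReal_le_ofReal hpopp)
      (Heis.covolume_le e hR.le hcov hc hcΓ)).trans_eq ?_)
    have hdet : |(Pi.basisFun ℝ (Fin n ⊕ Fin n)).det e| ≠ 0 :=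
      abs_ne_zero.mpr (Basis.isUnit_det _ e).ne_zero
    rw [← ENNReal.ofReal_mul (by positivity)]
    congr 1
    field_simp
  rw [ENNReal.ofReal_le_ofReal_iff (by positivity), le_div_iff₀ hη] at h1
  have h2 : η ≤ (2 * R) ^ (2 * n) / V * c := by
    rw [div_mul_eq_mul_div, le_div_iff₀ hV]
    linarith
  calc |symplForm n (γ i).proj (γ j).proj|
      ≤ K * η := abs_bilin_le e (symplForm n) (by positivity) hform (hle i) (hle j)
    _ ≤ K * ((2 * R) ^ (2 * n) / V * c) := mul_le_mul_of_nonneg_left h2 hK0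
    _ ≤ B * c := by
        rw [← mul_assoc]
        exact mul_le_mul_of_nonneg_right hB hc.le

/-- The center of a discrete subgroup whose projection spans is infinite cyclic. -/
theorem exists_center_generator (hn : 0 < n) {Γ : Subgroup (Heis n)} [DiscreteTopology Γ]
    {γ : Fin n ⊕ Fin n → Heis n} {l : Basis (Fin n ⊕ Fin n) ℝ (Fin n ⊕ Fin n → ℝ)}
    (hγ : ∀ i, γ i ∈ Γ) (hl : ∀ i, (γ i).proj = l i) :
    ∃ c : ℝ, 0 < c ∧ ∀ z : ℝ, Heis.mk 0 0 z ∈ Γ ↔ ∃ k : ℤ, z = k * c := by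
  let Z : AddSubgroup ℝ := Subgroup.toAddSubgroup' (Γ.comap (Heis.centerHom n))
  have hZ : ∀ z, z ∈ Z ↔ Heis.mk 0 0 z ∈ Γ := fun z => Iff.rfl
  have hdisc : DiscreteTopology Z := by
    let f : Z → Γ := fun z => ⟨Heis.mk 0 0 z, z.2⟩
    have hf : Continuous f :=
      (Heis.continuous_mk continuous_const continuous_const continuous_subtype_val).subtype_mk _
    refine DiscreteTopology.of_continuous_injective hf fun a b hab => ?_
    exact Subtype.ext (congrArg (fun p : Γ => (p : Heis n).z) hab)
  obtain ⟨a, ha⟩ : ∃ a, Z = AddSubgroup.zmultiples a := by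
    have := (AddSubgroup.isAddCyclic_iff_exists_zmultiples_eq_top (H := Z)).mp
      ((AddSubgroup.discrete_iff_addCyclic (H := Z)).mpr hdisc)
    exact this.imp fun _ h => h.symm
  have hmem : ∀ z, z ∈ Z ↔ ∃ k : ℤ, z = k * a := fun z => by
    rw [ha, AddSubgroup.mem_zmultiples_iff]
    simp [eq_comm]
  -- If Γ met the center trivially, all γ i would commute and the symplectic form would vanish on
  -- the basis l.
  have ha0 : a ≠ 0 := by
    rintro rfl
    refine symplForm_ne_zero hn ?_
    refine l.ext fun i => l.ext fun j => ?_
    have h1 : symplForm n (γ i).proj (γ j).proj ∈ Z := by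
      rw [hZ, ← Heis.commutator_eq]
      exact Γ.mul_mem (Γ.mul_mem (Γ.mul_mem (hγ i) (hγ j)) (Γ.inv_mem (hγ i))) (Γ.inv_mem (hγ j))
    simpa [hmem, hl] using h1
  refine ⟨|a|, abs_pos.mpr ha0, fun z => ?_⟩
  rw [← hZ, hmem]
  rcases abs_choice a with h | h
  · rw [h]
  · rw [h]
    constructor
    · rintro ⟨k, rfl⟩
      exact ⟨-k, by simp⟩
    · rintro ⟨k, rfl⟩
      exact ⟨-k, by simp⟩

end Bounds

end

/-! ### Frames of lattices and reduction modulo the determinant. -/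

noncomputable section

section LatticeData

variable {n : ℕ}

/-- The projection of a subgroup to the abelianization. -/
def Heis.projLattice (Γ : Subgroup (Heis n)) : AddSubgroup (Fin n ⊕ Fin n → ℝ) where
  carrier := {v | ∃ γ ∈ Γ, γ.proj = v}
  zero_mem' := ⟨1, Γ.one_mem, Heis.proj_one⟩
  add_mem' := by
    rintro _ _ ⟨a, ha, rfl⟩ ⟨b, hb, rfl⟩
    exact ⟨a * b, Γ.mul_mem ha hb, Heis.proj_mul a b⟩
  neg_mem' := by
    rintro _ ⟨a, ha, rfl⟩
    exact ⟨a⁻¹, Γ.inv_mem ha, Heis.proj_inv a⟩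

/-- The elements of `Γ` in the center are the multiples of `c`, and `l` is a real basis that lies
in the projection of `Γ` and has Gram matrix `c • M` for the symplectic form. -/
structure IsLatticeFrame (Γ : Subgroup (Heis n))
    (l : Basis (Fin n ⊕ Fin n) ℝ (Fin n ⊕ Fin n → ℝ)) (c : ℝ)
    (M : Matrix (Fin n ⊕ Fin n) (Fin n ⊕ Fin n) ℤ) : Prop where
  pos : 0 < c
  center : ∀ z : ℝ, Heis.mk 0 0 z ∈ Γ ↔ ∃ k : ℤ, z = k * c
  mem : ∀ i, l i ∈ Heis.projLattice Γ
  form : ∀ i j, symplForm n (l i) (l j) = M i j * c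

namespace IsLatticeFrame

variable {Γ Γ' : Subgroup (Heis n)} {l l' : Basis (Fin n ⊕ Fin n) ℝ (Fin n ⊕ Fin n → ℝ)} {c c' : ℝ}
  {M : Matrix (Fin n ⊕ Fin n) (Fin n ⊕ Fin n) ℤ}

theorem form_eq_mulVec (h : IsLatticeFrame Γ l c M) (i : Fin n ⊕ Fin n) (v : Fin n ⊕ Fin n → ℝ) :
    symplForm n (l i) v = c * (M.map (Int.cast : ℤ → ℝ)).mulVec (l.repr v) i := by
  conv_lhs => rw [← l.sum_repr v]
  simp only [map_sum, map_smul, smul_eq_mul, h.form, Matrix.mulVec, dotProduct, Matrix.map_apply,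
    Finset.mul_sum]
  exact Finset.sum_congr rfl fun j _ => by ring

/-- A real kernel vector of M would give a nonzero vector in the radical of the symplectic form. -/
theorem det_ne_zero (h : IsLatticeFrame Γ l c M) : M.det ≠ 0 := by
  intro h0
  have h1 : (M.map (Int.cast : ℤ → ℝ)).det = 0 := by
    have := (Int.castRingHom ℝ).map_det M
    rw [h0, map_zero] at this
    exact this.symm
  obtain ⟨t, ht, hMt⟩ := Matrix.exists_mulVec_eq_zero_iff.mpr h1
  refine ht ?_
  have hu : l.equivFun.symm t = 0 := by
    refine symplForm_nondegenerate fun v => ?_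
    rw [symplForm_neg_swap]
    have : (symplForm n).flip (l.equivFun.symm t) = 0 := by
      refine l.ext fun i => ?_
      change symplForm n (l i) (l.equivFun.symm t) = 0
      rw [h.form_eq_mulVec, show ⇑(l.repr (l.equivFun.symm t)) = t from
        l.equivFun.apply_symm_apply t, hMt]
      simp
    exact neg_eq_zero.mpr (LinearMap.congr_fun this v)
  exact (LinearEquiv.map_eq_zero_iff _).mp hu

/-- The projected lattice lies between the lattice spanned by `l` and a multiple of it. -/
theorem exists_det_mul_repr (h : IsLatticeFrame Γ l c M) {v : Fin n ⊕ Fin n → ℝ}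
    (hv : ∀ i, ∃ k : ℤ, symplForm n (l i) v = k * c) :
    ∃ k : Fin n ⊕ Fin n → ℤ, ∀ i, (M.det : ℝ) * l.repr v i = k i := by
  choose a ha using hv
  -- Cramer's rule: M sends the coordinates of v to the integral vector a, and the adjugate inverts
  -- M up to det M.
  refine ⟨M.adjugate.mulVec a, fun i => ?_⟩
  have h1 : (M.map (Int.cast : ℤ → ℝ)).mulVec (l.repr v) = fun i => (a i : ℝ) := by
    ext i
    have h2 := ha i
    rw [h.form_eq_mulVec, mul_comm] at h2
    exact mul_right_cancel₀ h.pos.ne' h2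
  have h2 : (M.adjugate.map (Int.cast : ℤ → ℝ)).mulVec
      ((M.map (Int.cast : ℤ → ℝ)).mulVec (l.repr v)) = (M.det : ℝ) • ⇑(l.repr v) := by
    rw [Matrix.mulVec_mulVec]
    have h3 := congrArg (fun A : Matrix _ _ ℤ => A.map (Int.castRingHom ℝ)) (Matrix.adjugate_mul M)
    simp only [Matrix.map_mul] at h3
    rw [show (M.adjugate.map (Int.cast : ℤ → ℝ)) * (M.map (Int.cast : ℤ → ℝ)) = _ from h3]
    have h4 : (M.det • (1 : Matrix (Fin n ⊕ Fin n) (Fin n ⊕ Fin n) ℤ)).map (Int.castRingHom ℝ) =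
        (M.det : ℝ) • 1 := by
      ext i j
      simp only [Matrix.map_apply, Matrix.smul_apply, Matrix.one_apply]
      split_ifs <;> simp
    rw [h4, Matrix.smul_mulVec, Matrix.one_mulVec]
  have h3 := congrFun h2 i
  rw [h1] at h3
  rw [Pi.smul_apply, smul_eq_mul] at h3
  rw [← h3]
  simp [Matrix.mulVec, dotProduct]

theorem exists_form_eq (h : IsLatticeFrame Γ l c M) {u v : Fin n ⊕ Fin n → ℝ}
    (hu : u ∈ Heis.projLattice Γ) (hv : v ∈ Heis.projLattice Γ) :
    ∃ k : ℤ, symplForm n u v = k * c := by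
  obtain ⟨a, ha, rfl⟩ := hu
  obtain ⟨b, hb, rfl⟩ := hv
  rw [← h.center, ← Heis.commutator_eq]
  exact Γ.mul_mem (Γ.mul_mem (Γ.mul_mem ha hb) (Γ.inv_mem ha)) (Γ.inv_mem hb)

theorem exists_det_mul_repr_of_mem (h : IsLatticeFrame Γ l c M) {v : Fin n ⊕ Fin n → ℝ}
    (hv : v ∈ Heis.projLattice Γ) :
    ∃ k : Fin n ⊕ Fin n → ℤ, ∀ i, (M.det : ℝ) * l.repr v i = k i :=
  h.exists_det_mul_repr fun i => h.exists_form_eq (h.mem i) hv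

/-- The point with coordinates `k / det M` in the basis `l`. -/
def point (l : Basis (Fin n ⊕ Fin n) ℝ (Fin n ⊕ Fin n → ℝ))
    (M : Matrix (Fin n ⊕ Fin n) (Fin n ⊕ Fin n) ℤ) (k : Fin n ⊕ Fin n → ℤ) : Fin n ⊕ Fin n → ℝ :=
  ∑ i, ((k i : ℝ) / M.det) • l i

/-- Coordinates of lattice points have denominator det M. Reducing the numerators modulo det M
changes the point by an integral combination of the frame, which lies in the lattice, so the points
in a finite box decide membership. -/
theorem equiv_mem (h : IsLatticeFrame Γ l c M) (h' : IsLatticeFrame Γ' l' c' M) {N : ℕ}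
    (hN : |M.det| ≤ N)
    (hmem : ∀ k : Fin n ⊕ Fin n → ℤ, (∀ i, k i ∈ Finset.Icc (0 : ℤ) N) →
      point l M k ∈ Heis.projLattice Γ → point l' M k ∈ Heis.projLattice Γ')
    {v : Fin n ⊕ Fin n → ℝ} (hv : v ∈ Heis.projLattice Γ) :
    l.equiv l' (Equiv.refl _) v ∈ Heis.projLattice Γ' := by
  obtain ⟨k, hk⟩ := h.exists_det_mul_repr_of_mem hv
  have hd : (M.det : ℝ) ≠ 0 := Int.cast_ne_zero.mpr h.det_ne_zero
  have hkr : ∀ i, l.repr v i = ((k i % M.det : ℤ) : ℝ) / M.det + (k i / M.det : ℤ) := fun i => by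
    have h1 : (k i : ℝ) = (k i % M.det : ℤ) + M.det * (k i / M.det : ℤ) := by
      exact_mod_cast (Int.emod_add_mul_ediv (k i) M.det).symm
    have h2 := hk i
    rw [h1] at h2
    field_simp
    linarith
  have hv2 : v = point l M (fun i => k i % M.det) + ∑ i, (k i / M.det) • l i := by
    conv_lhs => rw [← l.sum_repr v]
    simp only [point, ← Finset.sum_add_distrib, hkr, add_smul, Int.cast_smul_eq_zsmul]
  have hq : ∀ {Γ : Subgroup (Heis n)} {l : Basis (Fin n ⊕ Fin n) ℝ (Fin n ⊕ Fin n → ℝ)} {c : ℝ},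
      IsLatticeFrame Γ l c M → ∑ i, (k i / M.det) • l i ∈ Heis.projLattice Γ := fun h =>
    AddSubgroup.sum_mem _ fun i _ => AddSubgroup.zsmul_mem _ (h.mem i) _
  have h1 : point l M (fun i => k i % M.det) ∈ Heis.projLattice Γ := by
    have := AddSubgroup.sub_mem _ hv (hq h)
    rwa [hv2, add_sub_cancel_right] at this
  have h2 := hmem _ (fun i => Finset.mem_Icc.mpr ⟨Int.emod_nonneg _ h.det_ne_zero,
    (Int.emod_lt_abs _ h.det_ne_zero).le.trans hN⟩) h1
  have h3 : l.equiv l' (Equiv.refl _) v =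
      point l' M (fun i => k i % M.det) + ∑ i, (k i / M.det) • l' i := by
    conv_lhs => rw [hv2]
    simp only [point, map_add, map_sum, map_smul, map_zsmul, Basis.equiv_apply, Equiv.refl_apply]
  rw [h3]
  exact AddSubgroup.add_mem _ h2 (hq h')

theorem equiv_form (h : IsLatticeFrame Γ l c M) (h' : IsLatticeFrame Γ' l' c' M)
    (u v : Fin n ⊕ Fin n → ℝ) :
    symplForm n (l.equiv l' (Equiv.refl _) u) (l.equiv l' (Equiv.refl _) v) =
      c' / c * symplForm n u v := by
  have : (symplForm n).compl₁₂ (l.equiv l' (Equiv.refl _)).toLinearMap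
      (l.equiv l' (Equiv.refl _)).toLinearMap = (c' / c) • symplForm n := by
    refine l.ext fun i => l.ext fun j => ?_
    have := h.pos
    simp only [LinearMap.compl₁₂_apply, LinearEquiv.coe_coe, Basis.equiv_apply, Equiv.refl_apply,
      LinearMap.smul_apply, smul_eq_mul, h.form, h'.form]
    field_simp
  exact LinearMap.congr_fun (LinearMap.congr_fun this u) v

/-- The projected lattice has an integral basis that is a real basis. -/
theorem exists_integral_basis (h : IsLatticeFrame Γ l c M) :
    ∃ (ι : Type) (_ : Fintype ι) (β : Basis ι ℝ (Fin n ⊕ Fin n → ℝ)),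
      AddSubgroup.closure (range β) = Heis.projLattice Γ := by
  let L : Submodule ℤ (Fin n ⊕ Fin n → ℝ) := (Heis.projLattice Γ).toIntSubmodule
  have hd : (M.det : ℝ) ≠ 0 := Int.cast_ne_zero.mpr h.det_ne_zero
  -- The projected lattice lies in the integral span of l / det M, hence is discrete; it contains l,
  -- hence has full rank.
  let b := l.isUnitSMul (fun _ => (inv_ne_zero hd).isUnit)
  have hLb : (L : Set (Fin n ⊕ Fin n → ℝ)) ⊆ Submodule.span ℤ (range b) := by
    intro v hv
    obtain ⟨k, hk⟩ := h.exists_det_mul_repr_of_mem hv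
    have : v = ∑ i, k i • b i := by
      conv_lhs => rw [← l.sum_repr v]
      refine Finset.sum_congr rfl fun i _ => ?_
      rw [Basis.isUnitSMul_apply, ← Int.cast_smul_eq_zsmul ℝ, smul_smul, ← hk i]
      field_simp
    rw [this]
    exact Submodule.sum_mem _ fun i _ =>
      Submodule.smul_mem _ _ (Submodule.subset_span (mem_range_self i))
  have hdisc : DiscreteTopology L :=
    DiscreteTopology.of_subset (s := (Submodule.span ℤ (range b) : Set (Fin n ⊕ Fin n → ℝ)))
      (inferInstanceAs (DiscreteTopology (Submodule.span ℤ (range b)))) hLb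
  have hspan : IsZLattice ℝ L := ⟨eq_top_iff.mpr <| by
    rw [← l.span_eq]
    exact Submodule.span_mono (range_subset_iff.mpr h.mem)⟩
  have : Module.Free ℤ L := ZLattice.module_free ℝ L
  have : Module.Finite ℤ L := ZLattice.module_finite ℝ L
  let β := Module.finBasis ℤ L
  refine ⟨_, inferInstance, β.ofZLatticeBasis ℝ L, ?_⟩
  have h1 := β.ofZLatticeBasis_span ℝ
  rw [← Submodule.span_int_eq_addSubgroupClosure, h1]
  rfl

end IsLatticeFrame

end LatticeData

end

/-! ### Automorphisms of the Heisenberg group matching two lattices. -/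

noncomputable section

section Automorphisms

variable {n : ℕ}

/-- The automorphism `(u, z) ↦ (A u, r z + φ u)` for a conformally symplectic `A`. -/
def heisAut (A : (Fin n ⊕ Fin n → ℝ) ≃ₗ[ℝ] (Fin n ⊕ Fin n → ℝ)) {r : ℝ} (hr : r ≠ 0)
    (hA : ∀ u v, symplForm n (A u) (A v) = r * symplForm n u v)
    (φ : (Fin n ⊕ Fin n → ℝ) →ₗ[ℝ] ℝ) : Heis n ≃* Heis n where
  toFun p := Heis.ofProj (A p.proj) (r * p.z + φ p.proj)
  invFun p := Heis.ofProj (A.symm p.proj) (r⁻¹ * (p.z - φ (A.symm p.proj)))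
  left_inv p := Heis.ext_proj (by simp) (by simp [hr])
  right_inv p := Heis.ext_proj (by simp) (by simp [hr])
  map_mul' p q := Heis.ext_proj (by simp) (by
    simp only [Heis.z_ofProj, Heis.mul_z', Heis.proj_mul, Heis.proj_ofProj, hA, map_add]
    ring)

variable (A : (Fin n ⊕ Fin n → ℝ) ≃ₗ[ℝ] (Fin n ⊕ Fin n → ℝ)) {r : ℝ} (hr : r ≠ 0)
    (hA : ∀ u v, symplForm n (A u) (A v) = r * symplForm n u v)
    (φ : (Fin n ⊕ Fin n → ℝ) →ₗ[ℝ] ℝ)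

theorem heisAut_apply (p : Heis n) :
    heisAut A hr hA φ p = Heis.ofProj (A p.proj) (r * p.z + φ p.proj) := rfl

theorem contDiff_ofProj_comp {f : Heis n → Fin n ⊕ Fin n → ℝ} {g : Heis n → ℝ}
    (hf : ContDiff ℝ ∞ f) (hg : ContDiff ℝ ∞ g) :
    ContDiff ℝ ∞ (fun p => Heis.ofProj (f p) (g p)) := by
  have h1 : ContDiff ℝ ∞ (fun p => ((fun i => f p (Sum.inl i) : Fin n → ℝ),
      (fun i => f p (Sum.inr i) : Fin n → ℝ), g p)) :=
    (contDiff_pi.mpr fun i => contDiff_pi.mp hf _).prodMk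
      ((contDiff_pi.mpr fun i => contDiff_pi.mp hf _).prodMk hg)
  exact (Heis.coordCLM n).symm.contDiff.comp h1

theorem Heis.contDiff_proj : ContDiff ℝ ∞ (Heis.proj : Heis n → _) := (Heis.projCLM n).contDiff

theorem Heis.contDiff_z : ContDiff ℝ ∞ (Heis.z : Heis n → ℝ) :=
  contDiff_snd.comp (contDiff_snd.comp (Heis.coordCLM n).contDiff)

theorem contDiff_heisAut : ContDiff ℝ ∞ (heisAut A hr hA φ) :=
  contDiff_ofProj_comp (A.toContinuousLinearEquiv.contDiff.comp Heis.contDiff_proj)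
    ((contDiff_const.mul Heis.contDiff_z).add
      (φ.toContinuousLinearMap.contDiff.comp Heis.contDiff_proj))

theorem contDiff_heisAut_symm : ContDiff ℝ ∞ (heisAut A hr hA φ).symm := by
  have h := A.symm.toContinuousLinearEquiv.contDiff.comp (Heis.contDiff_proj (n := n))
  exact contDiff_ofProj_comp h (contDiff_const.mul
    (Heis.contDiff_z.sub (φ.toContinuousLinearMap.contDiff.comp h)))

theorem Heis.contDiff_mul_left (g : Heis n) : ContDiff ℝ ∞ (fun p => g * p) := by
  have h : (fun p : Heis n => g * p) = fun p => Heis.ofProj (g.proj + p.proj)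
      (g.z + p.z + 1 / 2 * symplForm n g.proj p.proj) := by
    ext1 p
    exact Heis.ext_proj (by simp) (by simp [symplForm_proj])
  rw [h]
  exact contDiff_ofProj_comp (contDiff_const.add Heis.contDiff_proj)
    ((contDiff_const.add Heis.contDiff_z).add (contDiff_const.mul
      ((symplForm n g.proj).toContinuousLinearMap.contDiff.comp Heis.contDiff_proj)))

/-- Inclusion between subgroups can be checked on lifts of generators of the projection and on
the center. -/
theorem Heis.subgroup_le_of_generators {Γ K : Subgroup (Heis n)} {ι : Type*} (γ : ι → Heis n)
    (hΓ : ∀ i, γ i ∈ Γ) (hK : ∀ i, γ i ∈ K)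
    (hgen : Heis.projLattice Γ ≤ AddSubgroup.closure (range fun i => (γ i).proj))
    (hcenter : ∀ z, Heis.mk 0 0 z ∈ Γ → Heis.mk 0 0 z ∈ K) : Γ ≤ K := by
  intro g hg
  have h1 : AddSubgroup.closure (range fun i => (γ i).proj) ≤ Heis.projLattice (Γ ⊓ K) := by
    rw [AddSubgroup.closure_le]
    rintro _ ⟨i, rfl⟩
    exact ⟨γ i, ⟨hΓ i, hK i⟩, rfl⟩
  obtain ⟨k, ⟨hk1, hk2⟩, hkg⟩ := h1 (hgen ⟨g, hg, rfl⟩)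
  have h2 : (g * k⁻¹).proj = 0 := by simp [hkg]
  have h3 : g * k⁻¹ ∈ K := by
    rw [Heis.eq_center_of_proj_eq_zero h2]
    refine hcenter _ ?_
    rw [← Heis.eq_center_of_proj_eq_zero h2]
    exact Γ.mul_mem hg (Γ.inv_mem hk1)
  simpa using K.mul_mem h3 hk2

/-- A conformally symplectic map between the projected lattices lifts to an automorphism of the
Heisenberg group that maps one lattice to the other. -/
theorem exists_heisAut_mem_iff {Γ Γ' : Subgroup (Heis n)} {c c' : ℝ} (hc : 0 < c) (hc' : 0 < c')
    (hcΓ : ∀ z : ℝ, Heis.mk 0 0 z ∈ Γ ↔ ∃ k : ℤ, z = k * c)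
    (hcΓ' : ∀ z : ℝ, Heis.mk 0 0 z ∈ Γ' ↔ ∃ k : ℤ, z = k * c')
    {ι : Type*} [Fintype ι] (β : Basis ι ℝ (Fin n ⊕ Fin n → ℝ))
    (hβ : AddSubgroup.closure (range β) = Heis.projLattice Γ)
    (A : (Fin n ⊕ Fin n → ℝ) ≃ₗ[ℝ] (Fin n ⊕ Fin n → ℝ))
    (hA : ∀ u v, symplForm n (A u) (A v) = c' / c * symplForm n u v)
    (hAΓ : ∀ v, A v ∈ Heis.projLattice Γ' ↔ v ∈ Heis.projLattice Γ) :
    ∃ φ : (Fin n ⊕ Fin n → ℝ) →ₗ[ℝ] ℝ, ∀ g,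
      heisAut A (div_pos hc' hc).ne' hA φ g ∈ Γ' ↔ g ∈ Γ := by
  have hβΓ : ∀ i, β i ∈ Heis.projLattice Γ := fun i =>
    hβ ▸ AddSubgroup.subset_closure (mem_range_self i)
  choose γ hγ hγβ using hβΓ
  choose γ' hγ' hγβ' using fun i => (hAΓ (β i)).mpr (hβ ▸ AddSubgroup.subset_closure (mem_range_self i))
  -- The lifts γ i must go to the lifts γ' i. As β is also a real basis, a linear form can absorb
  -- the discrepancies of their heights.
  let φ := β.constr ℝ (fun i => (γ' i).z - c' / c * (γ i).z)
  set Φ := heisAut A (div_pos hc' hc).ne' hA φ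
  have hΦγ : ∀ i, Φ (γ i) = γ' i := fun i => Heis.ext_proj
    (by rw [heisAut_apply, Heis.proj_ofProj, hγβ, hγβ'])
    (by rw [heisAut_apply, Heis.z_ofProj, hγβ, Basis.constr_basis]; ring)
  have hΦc : ∀ z, Φ (Heis.mk 0 0 z) = Heis.mk 0 0 (c' / c * z) := fun z => Heis.ext_proj
    (by rw [heisAut_apply]; simp) (by rw [heisAut_apply]; simp)
  have h1 : Γ ≤ Γ'.comap Φ.toMonoidHom := by
    refine Heis.subgroup_le_of_generators γ hγ (fun i => ?_) ?_ fun z hz => ?_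
    · change Φ (γ i) ∈ Γ'
      rw [hΦγ]
      exact hγ' i
    · rw [← hβ, show (fun i => (γ i).proj) = β from funext hγβ]
    · change Φ _ ∈ Γ'
      obtain ⟨k, rfl⟩ := (hcΓ z).mp hz
      rw [hΦc, hcΓ']
      exact ⟨k, by field_simp⟩
  have h2 : Γ' ≤ Γ.comap Φ.symm.toMonoidHom := by
    refine Heis.subgroup_le_of_generators γ' hγ' (fun i => ?_) ?_ fun z hz => ?_
    · change Φ.symm (γ' i) ∈ Γ
      rw [← hΦγ, MulEquiv.symm_apply_apply]
      exact hγ i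
    · intro v hv
      have h3 : A.symm v ∈ AddSubgroup.closure (range β) := by
        rw [hβ, ← hAΓ]
        simpa using hv
      have h4 : v ∈ (AddSubgroup.closure (range β)).map A.toLinearMap.toAddMonoidHom :=
        ⟨A.symm v, h3, by simp⟩
      rw [AddMonoidHom.map_closure, ← range_comp] at h4
      rwa [show (fun i => (γ' i).proj) = _ from funext hγβ']
    · change Φ.symm _ ∈ Γ
      obtain ⟨k, rfl⟩ := (hcΓ' z).mp hz
      have h5 : Φ.symm (Heis.mk 0 0 (k * c')) = Heis.mk 0 0 (k * c) := by
        rw [MulEquiv.symm_apply_eq, hΦc]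
        congr 1
        field_simp
      rw [h5, hcΓ]
      exact ⟨k, rfl⟩
  refine ⟨φ, fun g => ⟨fun h => ?_, fun h => h1 h⟩⟩
  have := h2 h
  change Φ.symm (Φ g) ∈ Γ at this
  rwa [MulEquiv.symm_apply_apply] at this

end Automorphisms

/-! ### Smooth maps between quotients. -/

section Quotients

variable {n : ℕ}

open MulAction

theorem isLocalHomeomorph_quotientMk (Γ : Subgroup (Heis n)) [DiscreteTopology Γ] :
    IsLocalHomeomorph (Quotient.mk (orbitRel Γ (Heis n))) :=
  isQuotientCoveringMap_quotientMk_of_properlyDiscontinuousSMul.isCoveringMap.isLocalHomeomorph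

theorem chartAt_quotient (Γ : Subgroup (Heis n)) [DiscreteTopology Γ]
    (q : orbitRel.Quotient Γ (Heis n)) :
    ∃ p : Heis n, Quotient.mk (orbitRel Γ (Heis n)) p = q ∧
      (chartAt (Heis n) q) = (isLocalHomeomorph_quotientMk Γ).localInverseAt p := by
  refine ⟨_, (Quotient.mk_surjective (s := orbitRel Γ (Heis n))).hasRightInverse.choose_spec q, ?_⟩
  change OpenPartialHomeomorph.trans _ (chartAt (Heis n) _) = _
  rw [chartAt_self_eq, OpenPartialHomeomorph.trans_refl]

/-- In the charts of the quotient, the projection is locally a left translation. -/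
theorem extChartAt_quotientMk (Γ : Subgroup (Heis n)) [DiscreteTopology Γ] (p : Heis n) :
    ∃ g : Heis n, (fun x => extChartAt 𝓘(ℝ, Heis n) (Quotient.mk (orbitRel Γ (Heis n)) p)
      (Quotient.mk (orbitRel Γ (Heis n)) x)) =ᶠ[nhds p] fun x => g * x := by
  obtain ⟨p', hp', hchart⟩ := chartAt_quotient Γ (Quotient.mk (orbitRel Γ (Heis n)) p)
  have hloc := isLocalHomeomorph_quotientMk Γ
  -- The chart may be a local inverse through another representative p' of the class; the required
  -- translation is the element of Γ taking p to p'.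
  obtain ⟨γ, hγ⟩ := Quotient.exact hp'
  have hγ : (γ : Heis n) * p = p' := hγ
  refine ⟨γ, ?_⟩
  have hmk : ∀ x, Quotient.mk (orbitRel Γ (Heis n)) ((γ : Heis n) * x) =
      Quotient.mk (orbitRel Γ (Heis n)) x := fun x => Quotient.sound ⟨γ, rfl⟩
  have h1 : ∀ᶠ x in nhds p, (γ : Heis n) * x ∈ (hloc.localInverseAt p').target := by
    refine (continuous_const_mul (γ : Heis n)).continuousAt.eventually_mem ?_
    rw [hγ]
    exact (hloc.localInverseAt p').open_target.mem_nhds hloc.self_mem_localInverseAt_target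
  filter_upwards [h1] with x hx
  simp only [extChartAt, OpenPartialHomeomorph.extend_coe, modelWithCornersSelf_coe,
    Function.comp_apply, id_eq, hchart]
  have h2 : (hloc.localInverseAt p').symm ((γ : Heis n) * x) =
      Quotient.mk (orbitRel Γ (Heis n)) x := by
    rw [hloc.localInverseAt_symm, hmk]
  rw [← h2, (hloc.localInverseAt p').right_inv hx]

/-- A smooth map that descends to the quotients is smooth on the quotients. -/
theorem contMDiff_quotient {Γ Γ' : Subgroup (Heis n)} [DiscreteTopology Γ] [DiscreteTopology Γ']
    {f : Heis n → Heis n} (hf : ContDiff ℝ ∞ f)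
    {F : orbitRel.Quotient Γ (Heis n) → orbitRel.Quotient Γ' (Heis n)}
    (hF : ∀ p, F (Quotient.mk (orbitRel Γ (Heis n)) p) = Quotient.mk (orbitRel Γ' (Heis n)) (f p)) :
    ContMDiff 𝓘(ℝ, Heis n) 𝓘(ℝ, Heis n) ∞ F := by
  have hcont : Continuous F := by
    refine (isQuotientMap_quotient_mk' (s := orbitRel Γ (Heis n))).continuous_iff.mpr ?_
    change Continuous (F ∘ Quotient.mk (orbitRel Γ (Heis n)))
    rw [show F ∘ _ = Quotient.mk (orbitRel Γ' (Heis n)) ∘ f from funext hF]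
    exact continuous_quotient_mk'.comp hf.continuous
  intro q
  rw [contMDiffAt_iff]
  refine ⟨hcont.continuousAt, ?_⟩
  obtain ⟨p, rfl, hchart⟩ := chartAt_quotient Γ q
  have hloc := isLocalHomeomorph_quotientMk Γ
  obtain ⟨g, hg⟩ := extChartAt_quotientMk Γ' (f p)
  have hsymm : ⇑(extChartAt 𝓘(ℝ, Heis n) (Quotient.mk (orbitRel Γ (Heis n)) p)).symm =
      Quotient.mk (orbitRel Γ (Heis n)) := by
    simp only [extChartAt, OpenPartialHomeomorph.extend_coe_symm, modelWithCornersSelf_coe_symm,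
      hchart, hloc.localInverseAt_symm, Function.comp_id]
  have hp : extChartAt 𝓘(ℝ, Heis n) (Quotient.mk (orbitRel Γ (Heis n)) p)
      (Quotient.mk (orbitRel Γ (Heis n)) p) = p := by
    simp only [extChartAt, OpenPartialHomeomorph.extend_coe, modelWithCornersSelf_coe,
      Function.comp_apply, id_eq, hchart, hloc.localInverseAt_apply_self]
  rw [hp, hsymm]
  refine ContDiffAt.contDiffWithinAt ?_
  refine (((Heis.contDiff_mul_left g).comp hf).contDiffAt (x := p)).congr_of_eventuallyEq ?_
  have := hf.continuous.continuousAt.eventually hg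
  filter_upwards [this] with x hx
  simp only [Function.comp_apply, hF]
  exact hx

/-- An automorphism that maps one lattice to another one induces an isomorphism of the lattices
and a diffeomorphism of the quotients. -/
theorem HeisLattice.equiv_of_automorphism {Γ Λ : HeisLattice n} (Φ : Heis n ≃* Heis n)
    (hΦ : ContDiff ℝ ∞ Φ) (hΦ' : ContDiff ℝ ∞ Φ.symm)
    (hmem : ∀ g, Φ g ∈ Λ.toSubgroup ↔ g ∈ Γ.toSubgroup) :
    Nonempty (Γ.toSubgroup ≃* Λ.toSubgroup) ∧
      Nonempty (Γ.Manifold ≃ₘ^∞⟮𝓘(ℝ, Heis n), 𝓘(ℝ, Heis n)⟯ Λ.Manifold) := by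
  have hmap : Γ.toSubgroup.map Φ.toMonoidHom = Λ.toSubgroup := by
    ext g
    constructor
    · rintro ⟨h, hh, rfl⟩
      exact (hmem h).mpr hh
    · intro hg
      exact ⟨Φ.symm g, (hmem _).mp (by simpa using hg), by simp⟩
  refine ⟨⟨(Φ.subgroupMap Γ.toSubgroup).trans (MulEquiv.subgroupCongr hmap)⟩, ?_⟩
  let e : Γ.Manifold ≃ Λ.Manifold := Quotient.congr Φ.toEquiv fun a b => by
    change a ∈ orbit _ _ ↔ Φ a ∈ orbit _ _
    constructor
    · rintro ⟨g, rfl⟩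
      exact ⟨⟨Φ g, (hmem g).mpr g.2⟩, (map_mul Φ _ _).symm⟩
    · rintro ⟨⟨g, hg⟩, h⟩
      refine ⟨⟨Φ.symm g, (hmem _).mp (by simpa using hg)⟩, Φ.injective ?_⟩
      have h : g * Φ b = Φ a := h
      change Φ (Φ.symm g * b) = Φ a
      rw [map_mul, MulEquiv.apply_symm_apply, h]
  exact ⟨⟨e, contMDiff_quotient hΦ fun p => rfl, contMDiff_quotient hΦ' fun p => rfl⟩⟩

end Quotients

end

/-! ### Finitely many invariants classify the lattices. -/

noncomputable section

section Finiteness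

variable {n : ℕ}

/-- One representative is chosen for each value of the invariant that occurs. -/
theorem exists_finset_card_le_of_fintype {α F : Type*} [Fintype F] (P : α → F → Prop) :
    ∃ T : Finset α, T.card ≤ Fintype.card F ∧ ∀ a x, P a x → ∃ b ∈ T, P b x := by
  classical
  let U : Finset F := Finset.univ.filter fun x => ∃ a, P a x
  have hU : ∀ x : U, ∃ a, P a x := fun x => (Finset.mem_filter.mp x.2).2
  choose f hf using hU
  refine ⟨U.attach.image f, ?_, fun a x h => ?_⟩
  · exact Finset.card_image_le.trans ((Finset.card_attach).trans_le (Finset.card_le_univ U))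
  · have hx : x ∈ U := Finset.mem_filter.mpr ⟨Finset.mem_univ x, a, h⟩
    exact ⟨f ⟨x, hx⟩, Finset.mem_image_of_mem f (Finset.mem_attach U _), hf ⟨x, hx⟩⟩

/-- A bound of the determinants of the integral matrices with entries bounded by `B`. -/
def detBound (n B : ℕ) : ℕ :=
  (Fintype.card (Fin n ⊕ Fin n)).factorial * B ^ Fintype.card (Fin n ⊕ Fin n)

theorem abs_det_le_detBound {B : ℕ} {M : Matrix (Fin n ⊕ Fin n) (Fin n ⊕ Fin n) ℤ}
    (hM : ∀ i j, |M i j| ≤ B) : |M.det| ≤ detBound n B := by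
  have := Matrix.det_le (A := M) (abv := AbsoluteValue.abs) (x := (B : ℤ)) hM
  simpa [detBound] using this

theorem IsLatticeFrame.abs_entry_le {Γ : Subgroup (Heis n)}
    {l : Basis (Fin n ⊕ Fin n) ℝ (Fin n ⊕ Fin n → ℝ)} {c : ℝ}
    {M : Matrix (Fin n ⊕ Fin n) (Fin n ⊕ Fin n) ℤ} (h : IsLatticeFrame Γ l c M) {B : ℕ}
    {i j : Fin n ⊕ Fin n} (hB : |symplForm n (l i) (l j)| ≤ B * c) : |M i j| ≤ B := by
  rw [h.form, abs_mul, abs_of_pos h.pos] at hB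
  exact_mod_cast le_of_mul_le_mul_right hB h.pos

/-- A lattice with a bounded family as in `exists_bounded_family` has a bounded frame. -/
theorem exists_isLatticeFrame (hn : 0 < n) {Γ : Subgroup (Heis n)} [DiscreteTopology Γ] {B : ℕ}
    {γ : Fin n ⊕ Fin n → Heis n} {l : Basis (Fin n ⊕ Fin n) ℝ (Fin n ⊕ Fin n → ℝ)}
    (hγ : ∀ i, γ i ∈ Γ) (hl : ∀ i, (γ i).proj = l i)
    (hB : ∀ c : ℝ, 0 < c → Heis.mk 0 0 c ∈ Γ → ∀ i j, |symplForm n (l i) (l j)| ≤ B * c) :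
    ∃ (c : ℝ) (M : Matrix (Fin n ⊕ Fin n) (Fin n ⊕ Fin n) ℤ), IsLatticeFrame Γ l c M ∧
      ∀ i j, |M i j| ≤ B := by
  obtain ⟨c, hc, hcenter⟩ := exists_center_generator hn hγ hl
  have hform : ∀ i j, ∃ k : ℤ, symplForm n (l i) (l j) = k * c := fun i j => by
    rw [← hl, ← hl, ← hcenter, ← Heis.commutator_eq]
    exact Γ.mul_mem (Γ.mul_mem (Γ.mul_mem (hγ i) (hγ j)) (Γ.inv_mem (hγ i))) (Γ.inv_mem (hγ j))
  choose M hM using hform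
  have h : IsLatticeFrame Γ l c (Matrix.of M) := ⟨hc, hcenter, fun i => ⟨γ i, hγ i, hl i⟩, hM⟩
  exact ⟨c, Matrix.of M, h, fun i j => h.abs_entry_le (hB c hc ((hcenter c).mpr ⟨1, by simp⟩) i j)⟩

/-- The finite set of invariants of lattices with a frame bounded by `B`. -/
abbrev FrameData (n B : ℕ) : Type :=
  (Fin n ⊕ Fin n → Fin n ⊕ Fin n → Finset.Icc (-(B : ℤ)) B) ×
    Set (Fin n ⊕ Fin n → Finset.Icc (0 : ℤ) (detBound n B))

/-- The lattice has a frame with the given Gram matrix, and the lattice points in a large box in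
the coordinates of the frame are the given ones. -/
def HasFrameData (B : ℕ) (Γ : HeisLattice n) (x : FrameData n B) : Prop :=
  ∃ (l : Basis (Fin n ⊕ Fin n) ℝ (Fin n ⊕ Fin n → ℝ)) (c : ℝ),
    IsLatticeFrame Γ.toSubgroup l c (Matrix.of fun i j => (x.1 i j : ℤ)) ∧
    ∀ k, k ∈ x.2 ↔ IsLatticeFrame.point l (Matrix.of fun i j => (x.1 i j : ℤ)) (fun i => k i) ∈
      Heis.projLattice Γ.toSubgroup

/-- The map A between the frames is conformally symplectic because the Gram matrices agree up to
scale. Using `equiv_mem` for A and its inverse, it matches the projected lattices and therefore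
lifts. -/
theorem HasFrameData.equiv {B : ℕ} {Γ Λ : HeisLattice n} {x : FrameData n B}
    (hΓ : HasFrameData B Γ x) (hΛ : HasFrameData B Λ x) :
    Nonempty (Γ.toSubgroup ≃* Λ.toSubgroup) ∧
      Nonempty (Γ.Manifold ≃ₘ^∞⟮𝓘(ℝ, Heis n), 𝓘(ℝ, Heis n)⟯ Λ.Manifold) := by
  obtain ⟨l, c, h, hk⟩ := hΓ
  obtain ⟨l', c', h', hk'⟩ := hΛ
  have hdet : |(Matrix.of fun i j => (x.1 i j : ℤ)).det| ≤ detBound n B :=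
    abs_det_le_detBound fun i j => abs_le.mpr (Finset.mem_Icc.mp (x.1 i j).2)
  let A := l.equiv l' (Equiv.refl _)
  have hA : ∀ v, A v ∈ Heis.projLattice Λ.toSubgroup ↔ v ∈ Heis.projLattice Γ.toSubgroup := by
    intro v
    constructor
    · intro hv
      have := h'.equiv_mem h hdet (fun k hkb hm =>
        (hk fun i => ⟨k i, hkb i⟩).mp ((hk' fun i => ⟨k i, hkb i⟩).mpr hm)) hv
      rwa [show l'.equiv l (Equiv.refl _) = A.symm by rw [Basis.equiv_symm]; rfl,
        LinearEquiv.symm_apply_apply] at this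
    · exact h.equiv_mem h' hdet fun k hkb hm =>
        (hk' fun i => ⟨k i, hkb i⟩).mp ((hk fun i => ⟨k i, hkb i⟩).mpr hm)
  obtain ⟨ι, _, β, hβ⟩ := h.exists_integral_basis
  obtain ⟨φ, hφ⟩ := exists_heisAut_mem_iff h.pos h'.pos h.center h'.center β hβ A
    (h.equiv_form h') hA
  exact HeisLattice.equiv_of_automorphism _ (contDiff_heisAut A _ _ φ)
    (contDiff_heisAut_symm A _ _ φ) hφ

theorem IsLatticeFrame.hasFrameData {B : ℕ} {Γ : HeisLattice n}
    {l : Basis (Fin n ⊕ Fin n) ℝ (Fin n ⊕ Fin n → ℝ)} {c : ℝ}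
    {M : Matrix (Fin n ⊕ Fin n) (Fin n ⊕ Fin n) ℤ} (h : IsLatticeFrame Γ.toSubgroup l c M)
    (hM : ∀ i j, |M i j| ≤ B) : ∃ x : FrameData n B, HasFrameData B Γ x :=
  ⟨⟨fun i j => ⟨M i j, Finset.mem_Icc.mpr (abs_le.mp (hM i j))⟩,
    {k | point l M (fun i => k i) ∈ Heis.projLattice Γ.toSubgroup}⟩, l, c, h, fun _ => Iff.rfl⟩

end Finiteness

/-! ### The standard lattices and their elementary divisors. -/

section StandardLattices

variable {n : ℕ}

/-- The group of the points with `xᵢ ∈ rᵢ ℤ`, `yᵢ ∈ ℤ` and `z - ½ x · y ∈ ℤ`. -/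
def integralPoints (r : Fin n → ℕ) : Subgroup (Heis n) where
  carrier := {p | ∃ (a b : Fin n → ℤ) (k : ℤ), (∀ i, p.x i = r i * a i) ∧ (∀ i, p.y i = b i) ∧
    p.z = k + 1 / 2 * ∑ i, p.x i * p.y i}
  one_mem' := ⟨0, 0, 0, by simp⟩
  mul_mem' := by
    rintro p q ⟨a, b, k, ha, hb, hk⟩ ⟨a', b', k', ha', hb', hk'⟩
    -- In the coordinate z - ½ x · y the cocycle of the group law becomes -y · x', which is integral
    -- on these points.
    refine ⟨a + a', b + b', k + k' - ∑ i, b i * (r i * a' i), fun i => ?_, fun i => ?_, ?_⟩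
    · simp [ha, ha', mul_add]
    · simp [hb, hb']
    · rw [Heis.mul_z, hk, hk']
      simp only [sympl, Heis.mul_x, Heis.mul_y, Pi.add_apply, ha, ha', hb, hb', Int.cast_add,
        Int.cast_sub, Int.cast_sum, Int.cast_mul, Int.cast_natCast, add_mul, mul_add,
        Finset.sum_add_distrib, Finset.sum_sub_distrib]
      have : ∑ i, (r i : ℝ) * a' i * b i = ∑ i, (b i : ℝ) * (r i * a' i) :=
        Finset.sum_congr rfl fun i _ => by ring
      rw [this]
      ring
  inv_mem' := by
    rintro p ⟨a, b, k, ha, hb, hk⟩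
    refine ⟨-a, -b, -k - ∑ i, r i * a i * b i, fun i => ?_, fun i => ?_, ?_⟩
    · simp [ha]
    · simp [hb]
    · rw [Heis.inv_z, hk]
      simp only [Heis.inv_x, Heis.inv_y, Pi.neg_apply, ha, hb, neg_mul_neg]
      push_cast
      ring

theorem latticeOf_le_integralPoints (r : Fin n → ℕ) : latticeOf r ≤ integralPoints r := by
  refine (Subgroup.closure_le _).mpr ?_
  rintro _ ((⟨i, rfl⟩ | ⟨i, rfl⟩) | rfl)
  · refine ⟨Pi.single i 1, 0, 0, fun j => ?_, fun j => ?_, ?_⟩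
    · rcases eq_or_ne j i with rfl | hj <;> simp_all [HeisAlg.exp, HeisAlg.stdBasis_X]
    · simp [HeisAlg.exp, HeisAlg.stdBasis_X]
    · simp [HeisAlg.exp, HeisAlg.stdBasis_X]
  · refine ⟨0, Pi.single i 1, 0, fun j => ?_, fun j => ?_, ?_⟩
    · simp [HeisAlg.exp, HeisAlg.stdBasis_Y]
    · rcases eq_or_ne j i with rfl | hj <;> simp_all [HeisAlg.exp, HeisAlg.stdBasis_Y]
    · simp [HeisAlg.exp, HeisAlg.stdBasis_Y]
  · exact ⟨0, 0, 1, by simp [HeisAlg.exp, HeisAlg.stdBasis_Z]⟩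

theorem center_mem_latticeOf (r : Fin n → ℕ) : Heis.mk 0 0 1 ∈ latticeOf r := by
  refine Subgroup.subset_closure (Or.inr ?_)
  rw [HeisAlg.stdBasis_Z]
  rfl

instance (r : Fin n → ℕ) : Countable (latticeOf r) := by
  let f : (Fin n → ℤ) × (Fin n → ℤ) × ℤ → Heis n := fun t =>
    Heis.mk (fun i => r i * t.1 i) (fun i => t.2.1 i)
      (t.2.2 + 1 / 2 * ∑ i, (r i : ℝ) * (t.1 i : ℝ) * (t.2.1 i : ℝ))
  refine ((countable_range f).mono fun p hp => ?_).to_subtype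
  obtain ⟨a, b, k, ha, hb, hk⟩ := latticeOf_le_integralPoints r hp
  refine ⟨(a, b, k), Heis.ext' (funext fun i => (ha i).symm) (funext fun i => (hb i).symm) ?_⟩
  rw [hk]
  simp only [ha, hb]
  rfl

theorem center_mem_latticeOf_iff (r : Fin n → ℕ) (z : ℝ) :
    Heis.mk 0 0 z ∈ latticeOf r ↔ ∃ k : ℤ, z = k * 1 := by
  constructor
  · intro h
    obtain ⟨a, b, k, -, -, hk⟩ := latticeOf_le_integralPoints r h
    exact ⟨k, by simpa using hk⟩
  · rintro ⟨k, rfl⟩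
    have := map_zpow (Heis.centerHom n) (Multiplicative.ofAdd 1) k
    rw [← ofAdd_zsmul] at this
    have h : Heis.mk 0 0 ((k : ℝ) * 1) = (Heis.mk 0 0 1 : Heis n) ^ k := by
      simpa [Heis.centerHom] using this
    rw [h]
    exact Subgroup.zpow_mem _ (center_mem_latticeOf r) k

/-- The elementary divisors of a standard lattice divide the determinant of every frame. -/
theorem IsLatticeFrame.dvd_det {r : Fin n → ℕ} {l : Basis (Fin n ⊕ Fin n) ℝ (Fin n ⊕ Fin n → ℝ)}
    {M : Matrix (Fin n ⊕ Fin n) (Fin n ⊕ Fin n) ℤ} (h : IsLatticeFrame (latticeOf r) l 1 M)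
    (i : Fin n) : (r i : ℤ) ∣ M.det := by
  -- This vector need not lie in the projected lattice, but it pairs integrally with it, as the
  -- y-coordinates there are integers. So det M • v is an integral combination of l and lies in the
  -- lattice, where i-th x-coordinates are multiples of r i.
  let v : Fin n ⊕ Fin n → ℝ := Pi.single (Sum.inl i) 1
  have hform : ∀ j, ∃ k : ℤ, symplForm n (l j) v = k * 1 := by
    intro j
    obtain ⟨γ, hγ, hγl⟩ := h.mem j
    obtain ⟨a, b, k, -, hb, -⟩ := latticeOf_le_integralPoints r hγ
    refine ⟨-b i, ?_⟩
    have h1 : l j (Sum.inr i) = b i := by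
      rw [← hγl, ← hb]
      rfl
    simp [symplForm_apply, v, Pi.single_apply, h1]
  obtain ⟨k, hk⟩ := h.exists_det_mul_repr hform
  have hv : (M.det : ℝ) • v = ∑ j, k j • l j := by
    conv_lhs => rw [← l.sum_repr v]
    rw [Finset.smul_sum]
    refine Finset.sum_congr rfl fun j _ => ?_
    rw [smul_smul, hk, Int.cast_smul_eq_zsmul]
  have hmem : (M.det : ℝ) • v ∈ Heis.projLattice (latticeOf r) := by
    rw [hv]
    exact AddSubgroup.sum_mem _ fun j _ => AddSubgroup.zsmul_mem _ (h.mem j) _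
  obtain ⟨γ, hγ, hγv⟩ := hmem
  obtain ⟨a, b, k, ha, -, -⟩ := latticeOf_le_integralPoints r hγ
  have h1 : γ.x i = (M.det : ℝ) := by
    have := congrFun hγv (Sum.inl i)
    simpa [v, Heis.proj] using this
  refine ⟨a i, ?_⟩
  have h2 := ha i
  rw [h1] at h2
  exact_mod_cast h2

end StandardLattices

end

/-! ### The finiteness theorem. -/

theorem proposition6p1 (n : ℕ) (hn : 0 < n) (D V : ℝ) (hD : 0 < D) (hV : 0 < V) :
    ∃ C : ℕ, 0 < C ∧
      (∀ (r : Fin n → ℕ), IsDivisorChain r → ∀ S : SubRiem n,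
        S.diam (latticeOf r) ≤ ENNReal.ofReal D →
        ENNReal.ofReal V ≤ S.totalMinPopp (latticeOf r) →
        r ⟨n - 1, Nat.sub_lt hn Nat.one_pos⟩ ≤ C) ∧
      ∃ T : Finset (HeisLattice n), T.card ≤ C ∧
        ∀ (Γ : HeisLattice n) (S : SubRiem n),
          S.diam Γ.toSubgroup ≤ ENNReal.ofReal D →
          ENNReal.ofReal V ≤ S.totalMinPopp Γ.toSubgroup →
          ∃ Λ ∈ T, Nonempty (Γ.toSubgroup ≃* Λ.toSubgroup) ∧
            Nonempty (Γ.Manifold ≃ₘ^∞⟮𝓘(ℝ, Heis n), 𝓘(ℝ, Heis n)⟯ Λ.Manifold) := by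
  classical
  obtain ⟨B, hB⟩ := exists_bounded_family hn hD hV
  obtain ⟨T, hT, hrep⟩ := exists_finset_card_le_of_fintype (HasFrameData (n := n) B)
  -- The determinant bound controls the largest divisor, the number of invariants controls the
  -- classes, and the added 1 makes the constant positive.
  refine ⟨max (detBound n B) (Fintype.card (FrameData n B)) + 1, Nat.succ_pos _, ?_, T,
    hT.trans ((le_max_right _ _).trans (Nat.le_succ _)), ?_⟩
  · intro r _ S hdiam hvol
    obtain ⟨γ, l, hγ, hl, hle⟩ := hB (latticeOf r) S hdiam hvol
    have hform : ∀ i j, ∃ k : ℤ, symplForm n (l i) (l j) = k * 1 := fun i j => by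
      rw [← hl, ← hl, ← center_mem_latticeOf_iff r, ← Heis.commutator_eq]
      exact mul_mem (mul_mem (mul_mem (hγ i) (hγ j)) (inv_mem (hγ i))) (inv_mem (hγ j))
    choose M hM using hform
    have h : IsLatticeFrame (latticeOf r) l 1 (Matrix.of M) :=
      ⟨one_pos, center_mem_latticeOf_iff r, fun i => ⟨γ i, hγ i, hl i⟩, hM⟩
    have hdet : |(Matrix.of M).det| ≤ detBound n B := abs_det_le_detBound fun i j =>
      h.abs_entry_le (hle 1 one_pos (center_mem_latticeOf r) i j)
    have h1 := Int.le_of_dvd (abs_pos.mpr h.det_ne_zero)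
      ((dvd_abs _ _).mpr (h.dvd_det ⟨n - 1, Nat.sub_lt hn Nat.one_pos⟩))
    have h2 := h1.trans hdet
    exact (Int.ofNat_le.mp h2).trans ((le_max_left _ _).trans (Nat.le_succ _))
  · intro Γ S hdiam hvol
    have : SecondCountableTopology (Heis n) :=
      inferInstanceAs (SecondCountableTopology ((Fin n → ℝ) × (Fin n → ℝ) × ℝ))
    have : Countable Γ.toSubgroup := TopologicalSpace.separableSpace_iff_countable.mp inferInstance
    obtain ⟨γ, l, hγ, hl, hle⟩ := hB Γ.toSubgroup S hdiam hvol
    obtain ⟨c, M, h, hM⟩ := exists_isLatticeFrame hn hγ hl hle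
    obtain ⟨x, hx⟩ := h.hasFrameData hM
    obtain ⟨Λ, hΛ, hxΛ⟩ := hrep Γ x hx
    exact ⟨Λ, hΛ, hx.equiv hxΛ⟩
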